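/- Let $k$ be an algebraically closed field of arbitrary characteristic, $R=k[x_0,x_1,x_2]$, and let $C\subset\mathbb P^2_k$ be an irreducible cubic curve, defined by an irreducible form $F\in R$ of degree $3$, which is singular at the point $P$ (that is, $F$ and its first partial derivatives vanish at $P$). For a finite set $X$ of (distinct) points of $\mathbb P^2_k$ let $2X$ be the double point scheme defined by the ideal $\bigcap_{p\in X}I(p)^2$, where $I(p)\subset R$ is the homogeneous ideal of $p$; let $h_{2X}(d)=\dim_k\big(R/\bigcap_{p\in X}I(p)^2\big)_d$ be its Hilbert function and $\Delta h_{2X}(d)=h_{2X}(d)-h_{2X}(d-1)$, with $h_{2X}(-1)=0$, its first difference. Let $t>3$ be an integer. If $X\subset C$ is a set of $3t+\delta$ points with $P\in X$ and $0\le\delta\le 2$, then $\Delta h_{2X}(d)=d+1$ for $0\le d\le 4$, and the remaining values are as follows. 1. If $\delta=0$: $\Delta h_{2X}(d)=6$ for $5\le d\le t+2$, $\Delta h_{2X}(t+3)=5$, $\Delta h_{2X}(d)=3$ for $t+4\le d\le 2t$, $\Delta h_{2X}(2t+1)=1$, and $\Delta h_{2X}(d)=0$ for $d\ge 2t+2$.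 2. If $\delta=1$: either (a) $\Delta h_{2X}(d)=6$ for $5\le d\le t+3$, $\Delta h_{2X}(d)=3$ for $t+4\le d\le 2t+1$, and $\Delta h_{2X}(d)=0$ for $d\ge 2t+2$; or (b) $\Delta h_{2X}(d)=6$ for $5\le d\le t+2$, $\Delta h_{2X}(t+3)=5$, $\Delta h_{2X}(t+4)=4$, $\Delta h_{2X}(d)=3$ for $t+5\le d\le 2t+1$, and $\Delta h_{2X}(d)=0$ for $d\ge 2t+2$. 3. If $\delta=2$: $\Delta h_{2X}(d)=6$ for $5\le d\le t+3$, $\Delta h_{2X}(t+4)=4$, $\Delta h_{2X}(d)=3$ for $t+5\le d\le 2t+1$, $\Delta h_{2X}(2t+2)=2$, and $\Delta h_{2X}(d)=0$ for $d\ge 2t+3$. Moreover, both possibilities in case 2 occur: for every such $C$, $P$ and $t>3$ there is a set $X\subset C$ of $3t+1$ points with $P\in X$ for which (a) holds, and there is one for which (b) holds. -/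

import Mathlib

open scoped LinearAlgebra.Projectivization

namespace FatPoints

noncomputable section

/-- The projective plane over `k`, as the set of lines through the origin of `k ^ 3`. -/
abbrev Plane (k : Type*) [Field k] : Type _ := ℙ k (Fin 3 → k)

variable {k : Type*} [Field k]

/-- The form `F` vanishes at the point `p`. (For homogeneous `F` this does not depend on the
representative of `p`; it is only used for homogeneous `F`.) -/
def VanishesAt (F : MvPolynomial (Fin 3) k) (p : Plane k) : Prop :=
  MvPolynomial.eval p.rep F = 0

/-- `p` is a singular point of the plane curve `F = 0`: the form `F` and all its first partial
derivatives vanish at `p`. -/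
def IsSingularPoint (F : MvPolynomial (Fin 3) k) (p : Plane k) : Prop :=
  VanishesAt F p ∧ ∀ i : Fin 3, VanishesAt (MvPolynomial.pderiv i F) p

/-- The homogeneous ideal `I(p)` of a point `p`, generated by all forms vanishing at `p`. -/
def pointIdeal (p : Plane k) : Ideal (MvPolynomial (Fin 3) k) :=
  Ideal.span {G | ∃ d : ℕ, G.IsHomogeneous d ∧ VanishesAt G p}

/-- The homogeneous ideal `⋂_{p ∈ X} I(p) ^ m` of the fat point scheme `mX`. -/
def fatIdeal (m : ℕ) (X : Finset (Plane k)) : Ideal (MvPolynomial (Fin 3) k) :=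
  ⨅ p ∈ X, pointIdeal p ^ m

/-- The Hilbert function `d ↦ dim_k (R / I)_d = dim_k (R_d / (I ∩ R_d))` of a homogeneous ideal
`I` of `R = k[x₀, x₁, x₂]`. -/
def hilbertFn (I : Ideal (MvPolynomial (Fin 3) k)) (d : ℕ) : ℕ :=
  Module.finrank k
    (MvPolynomial.homogeneousSubmodule (Fin 3) k d ⧸
      (I.restrictScalars k).comap (MvPolynomial.homogeneousSubmodule (Fin 3) k d).subtype)

/-- The first difference `Δh(d) = h(d) - h(d - 1)` of a function `h`, with `h(-1) = 0`. -/
def firstDiff (h : ℕ → ℕ) : ℕ → ℤ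
  | 0 => h 0
  | d + 1 => (h (d + 1) : ℤ) - h d

/-- The difference function `Δh_{2X}` of the double point scheme `2X`. -/
def doubleDiff (X : Finset (Plane k)) : ℕ → ℤ :=
  firstDiff (hilbertFn (fatIdeal 2 X))

/-- `1 2 3 4 5`, then `6` in degrees `5, …, t+2`, `5` in degree `t+3`, `3` in degrees
`t+4, …, 2t`, `1` in degree `2t+1`, and `0` from degree `2t+2` on. -/
def table0 (t d : ℕ) : ℤ :=
  if d ≤ 4 then d + 1
  else if d ≤ t + 2 then 6
  else if d = t + 3 then 5
  else if d ≤ 2 * t then 3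
  else if d = 2 * t + 1 then 1
  else 0

/-- `1 2 3 4 5`, then `6` in degrees `5, …, t+3`, `3` in degrees `t+4, …, 2t+1`, and `0` from
degree `2t+2` on. -/
def table1a (t d : ℕ) : ℤ :=
  if d ≤ 4 then d + 1
  else if d ≤ t + 3 then 6
  else if d ≤ 2 * t + 1 then 3
  else 0

/-- `1 2 3 4 5`, then `6` in degrees `5, …, t+2`, `5` in degree `t+3`, `4` in degree `t+4`, `3` in
degrees `t+5, …, 2t+1`, and `0` from degree `2t+2` on. -/
def table1b (t d : ℕ) : ℤ :=
  if d ≤ 4 then d + 1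
  else if d ≤ t + 2 then 6
  else if d = t + 3 then 5
  else if d = t + 4 then 4
  else if d ≤ 2 * t + 1 then 3
  else 0

/-- `1 2 3 4 5`, then `6` in degrees `5, …, t+3`, `4` in degree `t+4`, `3` in degrees
`t+5, …, 2t+1`, `2` in degree `2t+2`, and `0` from degree `2t+3` on. -/
def table2 (t d : ℕ) : ℤ :=
  if d ≤ 4 then d + 1
  else if d ≤ t + 3 then 6
  else if d = t + 4 then 4
  else if d ≤ 2 * t + 1 then 3
  else if d = 2 * t + 2 then 2
  else 0

end

end FatPoints

/-! An irreducible cubic with a singular point is rational. In suitable coordinates the singular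
point P is (0 : 0 : 1) and C is z x² + c(x, y) = 0 (cusp) or z x y + c(x, y) = 0 (node), in every
characteristic. It is parametrized by u ↦ (q : u q : -c) with q = 1 or q = X, and the smooth points
are those with q(u) ≠ 0 (`hasTables_of_normalForm`, `IsParamCubic`). Let the double points sit at P
and at n ≥ 6 smooth points, whose parameters are the roots of L.

Restriction to C has kernel F · R. A product F A is singular at P in any case, and at a smooth point
of C exactly when A vanishes there. So among the forms of degree d + 3 that are double along the
support, those vanishing on C are F times the forms of degree d through the n smooth points
(`doubleForms_inf_ker_eq_map`). The restrictions are exactly the polynomials q² L² s with deg s <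
3(d + 3) - 3 - 2n (`finrank_map_param_doubleForms`): a lift of such a polynomial is corrected by
some F A, where A is found by interpolation. For d ≥ 1 this gives h(d + 3) = 3(d + 3) + 3d - max(3(d
+ 3) - 3 - 2n, 0) - j(d), where j(d) is the dimension of the pullbacks of forms of degree d that are
divisible by L.

For d ≥ 1 these pullbacks form a hyperplane in the polynomials of degree at most 3d, given by one
gluing condition at P (`mem_curveForms_iff_gluing`). Hence j(d) = max(3d - n, 0), except when 3d =
n: then j(d) is 1 or 0 according to whether L itself satisfies the condition. The exception arises
only for n = 3t, and it separates the two tables for 3t + 1 points. By Vieta the condition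
prescribes the product (node) or the sum (cusp) of the negated parameters. Both outcomes occur by a
general position argument in the infinite groups kˣ and k (`exists_finset_prod_ne`,
`exists_finset_prod_eq`). -/

namespace FatPoints

open MvPolynomial

/-! ### Membership in I(p)² as vanishing of the form and its derivatives -/

section DoublePoints

variable {k : Type*} [Field k]

/-- The polynomial `G` and all its first partial derivatives vanish at the vector `v`. -/
def DoubleAt (v : Fin 3 → k) (G : MvPolynomial (Fin 3) k) : Prop :=
  eval v G = 0 ∧ ∀ i, eval v (pderiv i G) = 0

/-- Induction on forms: constants, sums, and multiplication by a variable. -/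
theorem homogeneous_induction {σ : Type*} {p : ℕ → MvPolynomial σ k → Prop}
    (hC : ∀ a, p 0 (C a)) (hadd : ∀ d G H, p d G → p d H → p d (G + H))
    (hX : ∀ d i G, G.IsHomogeneous d → p d G → p (d + 1) (X i * G)) [Nonempty σ]
    {d : ℕ} {G : MvPolynomial σ k} (hG : G.IsHomogeneous d) : p d G := by
  classical
  have hmon : ∀ d, ∀ s : σ →₀ ℕ, s.degree = d → ∀ a, p d (monomial s a) := by
    intro d
    induction d with
    | zero =>
      intro s hs a
      rw [Finsupp.degree_eq_zero_iff] at hs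
      subst hs
      exact hC a
    | succ d ih =>
      intro s hs a
      have hne : s ≠ 0 := by
        rintro rfl
        simp at hs
      obtain ⟨i, hi⟩ := Finsupp.ne_iff.1 hne
      have hle : Finsupp.single i 1 ≤ s := by
        rw [Finsupp.single_le_iff]
        exact Nat.one_le_iff_ne_zero.2 hi
      have hsum : Finsupp.single i 1 + (s - Finsupp.single i 1) = s := add_tsub_cancel_of_le hle
      have hdeg : (s - Finsupp.single i 1).degree = d := by
        have := congrArg Finsupp.degree hsum
        rw [map_add, Finsupp.degree_single, hs] at this
        omega
      have := hX d i (monomial (s - Finsupp.single i 1) a) (isHomogeneous_monomial a hdeg)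
        (ih _ hdeg a)
      rwa [X, monomial_mul, one_mul, hsum] at this
  have hzero : p d 0 := by
    induction d generalizing G with
    | zero => simpa using hC 0
    | succ d ih =>
      have := hX d (Classical.arbitrary σ) 0 (isHomogeneous_zero _ _ _)
        (ih (isHomogeneous_zero _ _ _))
      simpa using this
  rw [← G.support_sum_monomial_coeff]
  refine Finset.sum_induction _ (p d) (hadd d) hzero fun s hs => hmon d s ?_ _
  by_contra h
  exact (mem_support_iff.1 hs) (hG.coeff_eq_zero h)

theorem aeval_mul_of_isHomogeneous {A : Type*} [CommRing A] [Algebra k A] {d : ℕ}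
    {G : MvPolynomial (Fin 3) k} (hG : G.IsHomogeneous d) (s : A) (x : Fin 3 → A) :
    aeval (fun i => s * x i) G = s ^ d * aeval x G := by
  refine homogeneous_induction
    (p := fun d G => aeval (fun i => s * x i) G = s ^ d * aeval x G) ?_ ?_ ?_ hG
  · intro a
    simp
  · intro d G H h1 h2
    simp only [map_add, h1, h2]
    ring
  · intro d i G _ h
    simp only [map_mul, aeval_X, h]
    ring

theorem eval_smul_of_isHomogeneous {d : ℕ} {G : MvPolynomial (Fin 3) k}
    (hG : G.IsHomogeneous d) (a : k) (v : Fin 3 → k) :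
    eval (a • v) G = a ^ d * eval v G := by
  exact aeval_mul_of_isHomogeneous hG a v

theorem eval_eq_zero_smul_iff {d : ℕ} {G : MvPolynomial (Fin 3) k} (hG : G.IsHomogeneous d)
    {a : k} (ha : a ≠ 0) (v : Fin 3 → k) : eval (a • v) G = 0 ↔ eval v G = 0 := by
  rw [eval_smul_of_isHomogeneous hG]
  simp [ha]

theorem vanishesAt_mk {d : ℕ} {G : MvPolynomial (Fin 3) k} (hG : G.IsHomogeneous d)
    {v : Fin 3 → k} (hv : v ≠ 0) :
    VanishesAt G (Projectivization.mk k v hv) ↔ eval v G = 0 := by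
  obtain ⟨a, ha⟩ := Projectivization.exists_smul_eq_mk_rep k v hv
  rw [VanishesAt, ← ha]
  exact eval_eq_zero_smul_iff hG a.ne_zero v

theorem doubleAt_smul_iff {d : ℕ} {G : MvPolynomial (Fin 3) k} (hG : G.IsHomogeneous d)
    {a : k} (ha : a ≠ 0) (v : Fin 3 → k) : DoubleAt (a • v) G ↔ DoubleAt v G := by
  rw [DoubleAt, DoubleAt, eval_eq_zero_smul_iff hG ha]
  simp only [fun i => eval_eq_zero_smul_iff (hG.pderiv (i := i)) ha v]

/-- The first order Taylor expansion, modulo the square of an ideal. -/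
theorem aeval_add_sub_mem_sq {A : Type*} [CommRing A] [Algebra k A] {I : Ideal A}
    (a m : Fin 3 → A) (hm : ∀ i, m i ∈ I) (G : MvPolynomial (Fin 3) k) :
    aeval (a + m) G - (aeval a G + ∑ i, aeval a (pderiv i G) * m i) ∈ I ^ 2 := by
  classical
  induction G using MvPolynomial.induction_on with
  | C c => simp
  | add p q hp hq =>
    have := add_mem hp hq
    convert this using 1
    simp only [map_add, add_mul, Finset.sum_add_distrib]
    ring
  | mul_X p n hp =>
    have h1 := Ideal.mul_mem_right (a n + m n) _ hp
    have h2 : (∑ i, aeval a (pderiv i p) * m i) * m n ∈ I ^ 2 := by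
      rw [pow_two]
      exact Ideal.mul_mem_mul (sum_mem fun i _ => Ideal.mul_mem_left _ _ (hm i)) (hm n)
    have h3 : ∑ i, aeval a (pderiv i (p * X n)) * m i =
        a n * (∑ i, aeval a (pderiv i p) * m i) + aeval a p * m n := by
      have : ∀ i, aeval a (pderiv i (p * X n)) * m i =
          a n * (aeval a (pderiv i p) * m i) + (if n = i then aeval a p * m n else 0) := by
        intro i
        rw [pderiv_mul, pderiv_X, Pi.single_apply]
        split_ifs with h
        · subst h
          simp only [map_add, map_mul, aeval_X, mul_one]
          ring
        · simp only [map_add, map_mul, aeval_X, mul_zero, map_zero]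
          ring
      simp only [this, Finset.sum_add_distrib, ← Finset.mul_sum, Finset.sum_ite_eq,
        Finset.mem_univ, if_true]
    convert add_mem h1 h2 using 1
    rw [h3]
    simp only [map_mul, aeval_X, Pi.add_apply]
    ring

theorem eval_rep_of_mem_pointIdeal {p : Plane k} {G : MvPolynomial (Fin 3) k}
    (hG : G ∈ pointIdeal p) : eval p.rep G = 0 := by
  have : pointIdeal p ≤ RingHom.ker (eval p.rep) := by
    rw [pointIdeal, Ideal.span_le]
    rintro G ⟨d, -, h⟩
    exact h
  exact this hG

theorem doubleAt_rep_of_mem_sq {p : Plane k} {G : MvPolynomial (Fin 3) k}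
    (hG : G ∈ pointIdeal p ^ 2) : DoubleAt p.rep G := by
  rw [pow_two] at hG
  induction hG using Submodule.mul_induction_on' with
  | mem_mul_mem a ha b hb =>
    have h1 := eval_rep_of_mem_pointIdeal ha
    have h2 := eval_rep_of_mem_pointIdeal hb
    exact ⟨by simp [h1], fun i => by simp [h1, h2]⟩
  | add a _ b _ ha hb =>
    exact ⟨by simp [ha.1, hb.1], fun i => by simp [ha.2 i, hb.2 i]⟩

/-- The converse is a homogeneous Taylor expansion to first order: modulo I(p)², the multiple v_j^d
G is a combination of the value and the first partials of G at v. No division by integers occurs, so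
the characteristic is irrelevant. -/
theorem mem_pointIdeal_sq_iff_rep {d : ℕ} {G : MvPolynomial (Fin 3) k} (hG : G.IsHomogeneous d)
    (p : Plane k) : G ∈ pointIdeal p ^ 2 ↔ DoubleAt p.rep G := by
  refine ⟨doubleAt_rep_of_mem_sq, fun h => ?_⟩
  obtain ⟨j, hj⟩ := Function.ne_iff.1 p.rep_nonzero
  set v := p.rep with hv
  have hj : v j ≠ 0 := hj
  -- Base point X_j v and increment v_j X - X_j v, whose entries are linear forms through p. Their
  -- sum is v_j X, at which G takes the value v_j^d G.
  have key := aeval_add_sub_mem_sq (I := pointIdeal p) (fun i => X j * C (v i))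
    (fun i => C (v j) * X i - X j * C (v i)) (by
      intro i
      refine Ideal.subset_span ⟨1, ?_, ?_⟩
      · refine ((isHomogeneous_C_mul_X _ _).sub ?_)
        rw [mul_comm]
        exact isHomogeneous_C_mul_X _ _
      · simp only [VanishesAt, ← hv, map_sub, map_mul, eval_C, eval_X]
        ring) G
  have e1 : ((fun i => X j * C (v i)) + fun i => C (v j) * X i - X j * C (v i) :
      Fin 3 → MvPolynomial (Fin 3) k) = fun i => C (v j) * X i := by
    ext1 i
    simp only [Pi.add_apply]
    ring
  have e2 : ∀ (n : ℕ) (H : MvPolynomial (Fin 3) k), H.IsHomogeneous n → eval v H = 0 →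
      aeval (fun i => X j * C (v i) : Fin 3 → MvPolynomial (Fin 3) k) H = 0 := by
    intro n H hH h0
    rw [aeval_mul_of_isHomogeneous hH]
    have : aeval (fun i => C (v i) : Fin 3 → MvPolynomial (Fin 3) k) H = C (eval v H) := by
      rw [← aeval_eq_eval, ← algebraMap_eq, ← aeval_algebraMap_apply]
      rfl
    rw [this, h0, map_zero, mul_zero]
  rw [e1, aeval_mul_of_isHomogeneous hG, e2 d G hG h.1,
    Finset.sum_eq_zero fun i _ => by rw [e2 _ _ hG.pderiv (h.2 i), zero_mul], add_zero, sub_zero,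
    aeval_X_left_apply, ← C_pow] at key
  have := Ideal.mul_mem_left _ (C ((v j ^ d)⁻¹)) key
  rwa [← mul_assoc, ← C_mul, inv_mul_cancel₀ (pow_ne_zero _ hj), C_1, one_mul] at this

/-- A form lies in `I(p) ^ 2` exactly when it is singular at `p`. -/
theorem mem_pointIdeal_mk_sq_iff {d : ℕ} {G : MvPolynomial (Fin 3) k} (hG : G.IsHomogeneous d)
    {v : Fin 3 → k} (hv : v ≠ 0) :
    G ∈ pointIdeal (Projectivization.mk k v hv) ^ 2 ↔ DoubleAt v G := by
  obtain ⟨a, ha⟩ := Projectivization.exists_smul_eq_mk_rep k v hv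
  rw [mem_pointIdeal_sq_iff_rep hG, ← ha]
  exact doubleAt_smul_iff hG a.ne_zero v

theorem isSingularPoint_iff {d : ℕ} {G : MvPolynomial (Fin 3) k} (hG : G.IsHomogeneous d)
    (p : Plane k) : IsSingularPoint G p ↔ G ∈ pointIdeal p ^ 2 :=
  (mem_pointIdeal_sq_iff_rep hG p).symm

end DoublePoints

end FatPoints

namespace FatPoints

open MvPolynomial

/-! ### Invariance under linear changes of coordinates -/

section LinearChange

variable {k : Type*} [Field k]

/-- The conclusion about double points on the curve `F = 0` whose support contains `P`. -/
def HasTables (F : MvPolynomial (Fin 3) k) (P : Plane k) (t : ℕ) : Prop :=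
  (∀ X : Finset (Plane k), P ∈ X → (∀ Q ∈ X, VanishesAt F Q) →
      (X.card = 3 * t → doubleDiff X = table0 t) ∧
      (X.card = 3 * t + 1 → doubleDiff X = table1a t ∨ doubleDiff X = table1b t) ∧
      (X.card = 3 * t + 2 → doubleDiff X = table2 t)) ∧
    (∃ X : Finset (Plane k), P ∈ X ∧ (∀ Q ∈ X, VanishesAt F Q) ∧
      X.card = 3 * t + 1 ∧ doubleDiff X = table1a t) ∧
    (∃ X : Finset (Plane k), P ∈ X ∧ (∀ Q ∈ X, VanishesAt F Q) ∧
      X.card = 3 * t + 1 ∧ doubleDiff X = table1b t)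

/-- The substitution `G ↦ G ∘ e` for a linear automorphism `e` of `k ^ 3`. -/
noncomputable def linSubst (e : (Fin 3 → k) ≃ₗ[k] (Fin 3 → k)) :
    MvPolynomial (Fin 3) k →ₐ[k] MvPolynomial (Fin 3) k :=
  aeval fun i => ∑ j, C (e (Pi.single j 1) i) * X j

theorem eval_linSubst (e : (Fin 3 → k) ≃ₗ[k] (Fin 3 → k)) (v : Fin 3 → k)
    (G : MvPolynomial (Fin 3) k) : eval v (linSubst e G) = eval (e v) G := by
  have : ∀ i, ∑ j, e (Pi.single j 1) i * v j = e v i := by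
    intro i
    conv_rhs => rw [← Finset.univ_sum_single v]
    rw [map_sum, Finset.sum_apply]
    refine Finset.sum_congr rfl fun j _ => ?_
    have : (Pi.single j (v j) : Fin 3 → k) = v j • Pi.single j 1 := by
      rw [← Pi.single_smul, smul_eq_mul, mul_one]
    rw [this, map_smul, Pi.smul_apply, smul_eq_mul, mul_comm]
  induction G using MvPolynomial.induction_on with
  | C c => simp [linSubst]
  | add p q hp hq => rw [map_add, map_add, hp, hq, map_add]
  | mul_X p n hp =>
    rw [map_mul, map_mul, hp, map_mul, eval_X, linSubst, aeval_X, map_sum]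
    simp only [map_mul, eval_C, eval_X, this]

theorem linSubst_isHomogeneous (e : (Fin 3 → k) ≃ₗ[k] (Fin 3 → k)) {d : ℕ}
    {G : MvPolynomial (Fin 3) k} (hG : G.IsHomogeneous d) : (linSubst e G).IsHomogeneous d := by
  have := hG.aeval (fun i => ∑ j, C (e (Pi.single j 1) i) * X j) (n := 1)
    (fun i => IsHomogeneous.sum _ _ _ fun j _ => isHomogeneous_C_mul_X _ _)
  rwa [one_mul] at this

theorem linSubst_symm_linSubst [Infinite k] (e : (Fin 3 → k) ≃ₗ[k] (Fin 3 → k))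
    (G : MvPolynomial (Fin 3) k) : linSubst e.symm (linSubst e G) = G :=
  MvPolynomial.funext fun v => by rw [eval_linSubst, eval_linSubst, e.apply_symm_apply]

theorem linSubst_linSubst_symm [Infinite k] (e : (Fin 3 → k) ≃ₗ[k] (Fin 3 → k))
    (G : MvPolynomial (Fin 3) k) : linSubst e (linSubst e.symm G) = G :=
  MvPolynomial.funext fun v => by rw [eval_linSubst, eval_linSubst, e.symm_apply_apply]

/-- `linSubst` as an algebra automorphism. -/
noncomputable def linSubstEquiv [Infinite k] (e : (Fin 3 → k) ≃ₗ[k] (Fin 3 → k)) :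
    MvPolynomial (Fin 3) k ≃ₐ[k] MvPolynomial (Fin 3) k :=
  AlgEquiv.ofAlgHom (linSubst e) (linSubst e.symm)
    (AlgHom.ext fun G => linSubst_linSubst_symm e G)
    (AlgHom.ext fun G => linSubst_symm_linSubst e G)

/-- The projectivity of the plane induced by a linear automorphism of `k ^ 3`. -/
def planeMap (e : (Fin 3 → k) ≃ₗ[k] (Fin 3 → k)) : Plane k → Plane k :=
  Projectivization.map (e : (Fin 3 → k) →ₗ[k] (Fin 3 → k)) e.injective

theorem planeMap_mk (e : (Fin 3 → k) ≃ₗ[k] (Fin 3 → k)) (v : Fin 3 → k) (hv : v ≠ 0) :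
    planeMap e (Projectivization.mk k v hv) =
      Projectivization.mk k (e v) (by simpa using hv) := rfl

theorem planeMap_symm_planeMap (e : (Fin 3 → k) ≃ₗ[k] (Fin 3 → k)) (p : Plane k) :
    planeMap e.symm (planeMap e p) = p := by
  induction p using Projectivization.ind with
  | h v hv => simp only [planeMap_mk, e.symm_apply_apply]

theorem planeMap_planeMap_symm (e : (Fin 3 → k) ≃ₗ[k] (Fin 3 → k)) (p : Plane k) :
    planeMap e (planeMap e.symm p) = p := by
  induction p using Projectivization.ind with
  | h v hv => simp only [planeMap_mk, e.apply_symm_apply]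

theorem vanishesAt_linSubst (e : (Fin 3 → k) ≃ₗ[k] (Fin 3 → k)) {d : ℕ}
    {G : MvPolynomial (Fin 3) k} (hG : G.IsHomogeneous d) (p : Plane k) :
    VanishesAt (linSubst e G) p ↔ VanishesAt G (planeMap e p) := by
  induction p using Projectivization.ind with
  | h v hv =>
    rw [planeMap_mk, vanishesAt_mk (linSubst_isHomogeneous e hG), vanishesAt_mk hG, eval_linSubst]

theorem pointIdeal_le_comap (e : (Fin 3 → k) ≃ₗ[k] (Fin 3 → k)) (p : Plane k) :
    pointIdeal (planeMap e p) ≤ (pointIdeal p).comap (linSubst e) := by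
  rw [pointIdeal, Ideal.span_le]
  rintro G ⟨d, hG, h⟩
  exact Ideal.subset_span ⟨d, linSubst_isHomogeneous e hG, (vanishesAt_linSubst e hG p).2 h⟩

theorem linSubst_mem_pow (e : (Fin 3 → k) ≃ₗ[k] (Fin 3 → k)) {p : Plane k} {m : ℕ}
    {G : MvPolynomial (Fin 3) k} (h : G ∈ pointIdeal (planeMap e p) ^ m) :
    linSubst e G ∈ pointIdeal p ^ m := by
  have h1 := Ideal.mem_map_of_mem (linSubst e) h
  rw [Ideal.map_pow] at h1
  exact Ideal.pow_right_mono (Ideal.map_le_iff_le_comap.2 (pointIdeal_le_comap e p)) m h1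

theorem linSubst_mem_pow_iff [Infinite k] (e : (Fin 3 → k) ≃ₗ[k] (Fin 3 → k)) {p : Plane k}
    {m : ℕ} {G : MvPolynomial (Fin 3) k} :
    linSubst e G ∈ pointIdeal p ^ m ↔ G ∈ pointIdeal (planeMap e p) ^ m := by
  refine ⟨fun h => ?_, linSubst_mem_pow e⟩
  rw [← linSubst_symm_linSubst e G]
  refine linSubst_mem_pow e.symm ?_
  rwa [planeMap_symm_planeMap]

theorem mem_fatIdeal {m : ℕ} {X : Finset (Plane k)} {G : MvPolynomial (Fin 3) k} :
    G ∈ fatIdeal m X ↔ ∀ p ∈ X, G ∈ pointIdeal p ^ m := by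
  simp only [fatIdeal, Submodule.mem_iInf]

theorem linSubst_mem_fatIdeal_iff [Infinite k] [DecidableEq (Plane k)]
    (e : (Fin 3 → k) ≃ₗ[k] (Fin 3 → k)) {m : ℕ}
    {X : Finset (Plane k)} {G : MvPolynomial (Fin 3) k} :
    linSubst e G ∈ fatIdeal m X ↔ G ∈ fatIdeal m (X.image (planeMap e)) := by
  simp only [mem_fatIdeal, linSubst_mem_pow_iff, Finset.forall_mem_image]

theorem hilbertFn_image [Infinite k] [DecidableEq (Plane k)] (e : (Fin 3 → k) ≃ₗ[k] (Fin 3 → k))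
    (m : ℕ) (X : Finset (Plane k)) :
    hilbertFn (fatIdeal m (X.image (planeMap e))) = hilbertFn (fatIdeal m X) := by
  funext d
  let E := (linSubstEquiv e).toLinearEquiv.submoduleMap (homogeneousSubmodule (Fin 3) k d)
  have hE : (homogeneousSubmodule (Fin 3) k d).map
      ((linSubstEquiv e).toLinearEquiv : MvPolynomial (Fin 3) k →ₗ[k] MvPolynomial (Fin 3) k) =
      homogeneousSubmodule (Fin 3) k d := by
    ext G
    simp only [Submodule.mem_map]
    constructor
    · rintro ⟨H, hH, rfl⟩
      exact linSubst_isHomogeneous e hH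
    · intro hG
      exact ⟨linSubst e.symm G, linSubst_isHomogeneous e.symm hG, linSubst_linSubst_symm e G⟩
  let E' := E.trans (LinearEquiv.ofEq _ _ hE)
  refine (Submodule.Quotient.equiv _ _ E' ?_).finrank_eq
  ext ⟨G, hG⟩
  rw [Submodule.mem_map_equiv]
  have h : linSubst e ((E'.symm ⟨G, hG⟩ : homogeneousSubmodule (Fin 3) k d) :
      MvPolynomial (Fin 3) k) = G := congrArg Subtype.val (E'.apply_symm_apply ⟨G, hG⟩)
  simp only [Submodule.mem_comap, Submodule.restrictScalars_mem, Submodule.subtype_apply]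
  rw [← linSubst_mem_fatIdeal_iff, h]

theorem hasTables_of_linSubst [Infinite k] (e : (Fin 3 → k) ≃ₗ[k] (Fin 3 → k)) {d : ℕ}
    {F : MvPolynomial (Fin 3) k} (hF : F.IsHomogeneous d) {P : Plane k} {t : ℕ}
    (h : HasTables (linSubst e F) (planeMap e.symm P) t) : HasTables F P t := by
  classical
  have inj : Function.Injective (planeMap e) :=
    Function.LeftInverse.injective (planeMap_symm_planeMap e)
  have inj' : Function.Injective (planeMap e.symm) :=
    Function.LeftInverse.injective (planeMap_planeMap_symm e)
  have hdiff : ∀ X : Finset (Plane k), doubleDiff (X.image (planeMap e)) = doubleDiff X := by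
    intro X
    rw [doubleDiff, doubleDiff, hilbertFn_image]
  have hdiff' : ∀ X : Finset (Plane k), doubleDiff (X.image (planeMap e.symm)) = doubleDiff X := by
    intro X
    rw [doubleDiff, doubleDiff, hilbertFn_image]
  have push : ∀ T : ℕ → ℤ, (∃ X : Finset (Plane k), planeMap e.symm P ∈ X ∧
      (∀ Q ∈ X, VanishesAt (linSubst e F) Q) ∧ X.card = 3 * t + 1 ∧ doubleDiff X = T) →
      ∃ X : Finset (Plane k), P ∈ X ∧ (∀ Q ∈ X, VanishesAt F Q) ∧ X.card = 3 * t + 1 ∧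
      doubleDiff X = T := by
    rintro T ⟨X, hP, hX, hc, hT⟩
    refine ⟨X.image (planeMap e), ?_, ?_, ?_, ?_⟩
    · rw [← planeMap_planeMap_symm e P]
      exact Finset.mem_image_of_mem _ hP
    · rw [Finset.forall_mem_image]
      exact fun Q hQ => (vanishesAt_linSubst e hF Q).1 (hX Q hQ)
    · rw [Finset.card_image_of_injective _ inj, hc]
    · rw [hdiff, hT]
  refine ⟨fun X hP hX => ?_, push _ h.2.1, push _ h.2.2⟩
  have := h.1 (X.image (planeMap e.symm)) (Finset.mem_image_of_mem _ hP) (by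
    rw [Finset.forall_mem_image]
    intro Q hQ
    rw [vanishesAt_linSubst e hF, planeMap_planeMap_symm]
    exact hX Q hQ)
  rwa [Finset.card_image_of_injective _ inj', hdiff'] at this

end LinearChange

end FatPoints

namespace FatPoints

open MvPolynomial

/-! ### Normal forms of an irreducible singular cubic -/

section NormalForm

variable {k : Type*} [Field k]

theorem exists_eq_sum_X_mul {d : ℕ} {G : MvPolynomial (Fin 3) k} (hG : G.IsHomogeneous (d + 1)) :
    ∃ g : Fin 3 → MvPolynomial (Fin 3) k, (∀ i, (g i).IsHomogeneous d) ∧ G = ∑ i, X i * g i := by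
  refine homogeneous_induction (p := fun n G => ∀ d, n = d + 1 →
    ∃ g : Fin 3 → MvPolynomial (Fin 3) k, (∀ i, (g i).IsHomogeneous d) ∧ G = ∑ i, X i * g i)
    ?_ ?_ ?_ hG d rfl
  · intro a d h
    omega
  · intro n G H hG hH d hd
    obtain ⟨g, hg, rfl⟩ := hG d hd
    obtain ⟨h, hh, rfl⟩ := hH d hd
    exact ⟨g + h, fun i => (hg i).add (hh i), by
      simp only [Pi.add_apply, mul_add, Finset.sum_add_distrib]⟩
  · intro n i G hG _ d hd
    obtain rfl : n = d := by omega
    refine ⟨Pi.single i G, fun j => ?_, ?_⟩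
    · by_cases h : j = i
      · subst h
        simpa using hG
      · simp only [Pi.single_apply, if_neg h]
        exact isHomogeneous_zero _ _ _
    · simp [Pi.single_apply]

theorem exists_eq_C {G : MvPolynomial (Fin 3) k} (hG : G.IsHomogeneous 0) : ∃ a, G = C a :=
  ⟨_, totalDegree_eq_zero_iff_eq_C.1 ((totalDegree_zero_iff_isHomogeneous _).2 hG)⟩

/-- The coordinate vector of the point `(0 : 0 : 1)`. -/
def apexVec (k : Type*) [Field k] : Fin 3 → k := ![0, 0, 1]

theorem apexVec_ne_zero : apexVec k ≠ 0 := fun h => by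
  simpa [apexVec] using congrFun h 2

/-- The point `(0 : 0 : 1)`. -/
def apex (k : Type*) [Field k] : Plane k := Projectivization.mk k (apexVec k) apexVec_ne_zero

/-- A cubic form that is singular at `(0 : 0 : 1)`. -/
noncomputable def conicCubic (a b g c₀ c₁ c₂ c₃ : k) : MvPolynomial (Fin 3) k :=
  X 2 * (C a * X 0 ^ 2 + C b * (X 0 * X 1) + C g * X 1 ^ 2) +
    (C c₀ * X 1 ^ 3 + C c₁ * (X 0 * X 1 ^ 2) + C c₂ * (X 0 ^ 2 * X 1) + C c₃ * X 0 ^ 3)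

/-- Vanishing of F, ∂₀F and ∂₁F at (0 : 0 : 1) removes the monomials z³, z²x and z²y. -/
theorem exists_eq_conicCubic {F : MvPolynomial (Fin 3) k} (hF : F.IsHomogeneous 3)
    (hP : DoubleAt (apexVec k) F) : ∃ a b g c₀ c₁ c₂ c₃, F = conicCubic a b g c₀ c₁ c₂ c₃ := by
  obtain ⟨f, hf, rfl⟩ := exists_eq_sum_X_mul hF
  choose f2 hf2 h2 using fun i => exists_eq_sum_X_mul (hf i)
  choose f3 hf3 h3 using fun i j => exists_eq_sum_X_mul (hf2 i j)
  choose A hA using fun i j l => exists_eq_C (hf3 i j l)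
  simp only [h2, h3, hA, Fin.sum_univ_three] at hP ⊢
  obtain ⟨h0, h1⟩ := hP
  have e0 := h1 0
  have e1 := h1 1
  simp [apexVec, pderiv_X] at h0 e0 e1
  -- The array `A` need not be symmetric, so each coefficient of F is a sum over the orderings of
  -- its monomial.
  refine ⟨A 0 0 2 + A 0 2 0 + A 2 0 0,
    A 0 1 2 + A 0 2 1 + A 1 0 2 + A 1 2 0 + A 2 0 1 + A 2 1 0, A 1 1 2 + A 1 2 1 + A 2 1 1,
    A 1 1 1, A 0 1 1 + A 1 0 1 + A 1 1 0, A 0 0 1 + A 0 1 0 + A 1 0 0, A 0 0 0, ?_⟩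
  have e2 : (C (A 2 2 2) : MvPolynomial (Fin 3) k) = 0 := by rw [h0, C_0]
  have e3 : (C (A 0 2 2) + C (A 2 0 2) + C (A 2 2 0) : MvPolynomial (Fin 3) k) = 0 := by
    rw [← C_add, ← C_add, ← C_0]
    congr 1
    linear_combination e0
  have e4 : (C (A 1 2 2) + C (A 2 1 2) + C (A 2 2 1) : MvPolynomial (Fin 3) k) = 0 := by
    rw [← C_add, ← C_add, ← C_0]
    congr 1
    linear_combination e1
  simp only [conicCubic, C_add]
  linear_combination X 2 ^ 3 * e2 + X 2 ^ 2 * X 0 * e3 + X 2 ^ 2 * X 1 * e4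

theorem not_irreducible_X_mul {F G : MvPolynomial (Fin 3) k} (i : Fin 3) (h : F = X i * G)
    (hF : F.IsHomogeneous 3) : ¬ Irreducible F := by
  intro hirr
  rcases hirr.isUnit_or_isUnit h with h1 | h1
  · obtain ⟨r, -, hr⟩ := isUnit_iff_eq_C_of_isReduced.1 h1
    have h2 : (X i : MvPolynomial (Fin 3) k).totalDegree = 0 := by rw [hr, totalDegree_C]
    simp at h2
  · obtain ⟨r, -, hr⟩ := isUnit_iff_eq_C_of_isReduced.1 h1
    have h2 : F.IsHomogeneous 1 := by
      rw [h, hr, mul_comm]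
      exact isHomogeneous_C_mul_X _ _
    have := hF.inj_right h2 hirr.ne_zero
    omega

theorem exists_linearEquiv_mulVec (M : Matrix (Fin 3) (Fin 3) k) (h : M.det ≠ 0) :
    ∃ e : (Fin 3 → k) ≃ₗ[k] (Fin 3 → k), ∀ v, e v = M.mulVec v := by
  have := M.invertibleOfIsUnitDet (Ne.isUnit h)
  exact ⟨Matrix.toLinearEquiv' M this, fun v => rfl⟩

theorem irreducible_linSubst [Infinite k] (e : (Fin 3 → k) ≃ₗ[k] (Fin 3 → k))
    {F : MvPolynomial (Fin 3) k} (hF : Irreducible F) : Irreducible (linSubst e F) :=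
  (MulEquiv.irreducible_iff (linSubstEquiv e)).2 hF

/-- A reduction step: a linear change of coordinates that fixes the point `(0 : 0 : 1)`. -/
theorem linSubst_data [Infinite k] {F : MvPolynomial (Fin 3) k} (hF : F.IsHomogeneous 3)
    (hirr : Irreducible F) (M : Matrix (Fin 3) (Fin 3) k) (h : M.det ≠ 0) {v : Fin 3 → k}
    (hv : v ≠ 0) {s : k} (hM : M.mulVec (apexVec k) = s • v)
    (hP : DoubleAt v F) :
    ∃ F' : MvPolynomial (Fin 3) k, F'.IsHomogeneous 3 ∧ Irreducible F' ∧
      DoubleAt (apexVec k) F' ∧ (∀ w, eval w F' = eval (M.mulVec w) F) ∧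
      ∀ t, HasTables F' (apex k) t → HasTables F (Projectivization.mk k v hv) t := by
  obtain ⟨e, he⟩ := exists_linearEquiv_mulVec M h
  have hpt : planeMap e (apex k) = Projectivization.mk k v hv := by
    rw [apex, planeMap_mk, Projectivization.mk_eq_mk_iff']
    exact ⟨s, by rw [he, hM]⟩
  refine ⟨linSubst e F, linSubst_isHomogeneous e hF, irreducible_linSubst e hirr, ?_, ?_, ?_⟩
  · rw [← mem_pointIdeal_mk_sq_iff (linSubst_isHomogeneous e hF) apexVec_ne_zero]
    rw [← mem_pointIdeal_mk_sq_iff hF hv, ← hpt] at hP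
    exact linSubst_mem_pow e hP
  · intro w
    rw [eval_linSubst, he]
  · intro t ht
    refine hasTables_of_linSubst e hF ?_
    rwa [← hpt, planeMap_symm_planeMap]

theorem mulVec_of_fin_three (M : Matrix (Fin 3) (Fin 3) k) (v : Fin 3 → k) :
    M.mulVec v = ![M 0 0 * v 0 + M 0 1 * v 1 + M 0 2 * v 2,
      M 1 0 * v 0 + M 1 1 * v 1 + M 1 2 * v 2, M 2 0 * v 0 + M 2 1 * v 1 + M 2 2 * v 2] := by
  ext i
  fin_cases i <;> simp [Matrix.mulVec, dotProduct, Fin.sum_univ_three]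

theorem exists_moving_to_apex [Infinite k] {F : MvPolynomial (Fin 3) k} (hF : F.IsHomogeneous 3)
    (hirr : Irreducible F) {P : Plane k} (hP : IsSingularPoint F P) :
    ∃ F' : MvPolynomial (Fin 3) k, F'.IsHomogeneous 3 ∧ Irreducible F' ∧
      DoubleAt (apexVec k) F' ∧ ∀ t, HasTables F' (apex k) t → HasTables F P t := by
  rw [isSingularPoint_iff hF] at hP
  induction P using Projectivization.ind with
  | h v hv =>
  rw [mem_pointIdeal_mk_sq_iff hF hv] at hP
  have key : ∀ M : Matrix (Fin 3) (Fin 3) k, M.det ≠ 0 → M.mulVec (apexVec k) = v →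
      ∃ F' : MvPolynomial (Fin 3) k, F'.IsHomogeneous 3 ∧ Irreducible F' ∧
      DoubleAt (apexVec k) F' ∧
      ∀ t, HasTables F' (apex k) t → HasTables F (Projectivization.mk k v hv) t := by
    intro M hM hMv
    obtain ⟨F', h1, h2, h3, -, h5⟩ := linSubst_data hF hirr M hM hv (s := 1)
      (by rw [one_smul, hMv]) hP
    exact ⟨F', h1, h2, h3, h5⟩
  have hv3 : v = ![v 0, v 1, v 2] := by
    ext i
    fin_cases i <;> rfl
  by_cases h2 : v 2 = 0
  · by_cases h1 : v 1 = 0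
    · have h0 : v 0 ≠ 0 := by
        intro h0
        apply hv
        rw [hv3, h0, h1, h2]
        ext i
        fin_cases i <;> rfl
      refine key !![0, 0, v 0; 1, 0, v 1; 0, 1, v 2] (by simpa [Matrix.det_fin_three] using h0) ?_
      conv_rhs => rw [hv3]
      rw [mulVec_of_fin_three]
      simp [apexVec]
    · refine key !![1, 0, v 0; 0, 0, v 1; 0, 1, v 2] (by simpa [Matrix.det_fin_three] using h1) ?_
      conv_rhs => rw [hv3]
      rw [mulVec_of_fin_three]
      simp [apexVec]
  · refine key !![1, 0, v 0; 0, 1, v 1; 0, 0, v 2] (by simpa [Matrix.det_fin_three] using h2) ?_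
    conv_rhs => rw [hv3]
    rw [mulVec_of_fin_three]
    simp [apexVec]

theorem eval_conicCubic (a b g c₀ c₁ c₂ c₃ : k) (v : Fin 3 → k) :
    eval v (conicCubic a b g c₀ c₁ c₂ c₃) =
      v 2 * (a * v 0 ^ 2 + b * (v 0 * v 1) + g * v 1 ^ 2) +
    (c₀ * v 1 ^ 3 + c₁ * (v 0 * v 1 ^ 2) + c₂ * (v 0 ^ 2 * v 1) + c₃ * v 0 ^ 3) := by
  simp [conicCubic]

/-- Moving the point `(x : y)` of the pencil of lines through `(0 : 0 : 1)` to `(0 : 1)`. -/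
theorem exists_rotation [Infinite k] {F : MvPolynomial (Fin 3) k} (hF : F.IsHomogeneous 3)
    (hirr : Irreducible F) (hP : DoubleAt (apexVec k) F) {x y : k} (hxy : x ≠ 0 ∨ y ≠ 0) :
    ∃ F' : MvPolynomial (Fin 3) k, F'.IsHomogeneous 3 ∧ Irreducible F' ∧
      DoubleAt (apexVec k) F' ∧ (∀ z, eval ![0, 1, z] F' = eval ![x, y, z] F) ∧
      ∀ t, HasTables F' (apex k) t → HasTables F (apex k) t := by
  rcases hxy with h | h
  · obtain ⟨F', h1, h2, h3, h4, h5⟩ := linSubst_data hF hirr !![0, x, 0; 1, y, 0; 0, 0, 1]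
      (by simpa [Matrix.det_fin_three] using h) apexVec_ne_zero (s := 1)
      (by rw [mulVec_of_fin_three]; simp [apexVec]) hP
    exact ⟨F', h1, h2, h3, fun z => by rw [h4, mulVec_of_fin_three]; simp, h5⟩
  · obtain ⟨F', h1, h2, h3, h4, h5⟩ := linSubst_data hF hirr !![1, x, 0; 0, y, 0; 0, 0, 1]
      (by simpa [Matrix.det_fin_three] using h) apexVec_ne_zero (s := 1)
      (by rw [mulVec_of_fin_three]; simp [apexVec]) hP
    exact ⟨F', h1, h2, h3, fun z => by rw [h4, mulVec_of_fin_three]; simp, h5⟩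

/-- An irreducible cubic contains no line through its singular point. Once the line is rotated to x
= 0, the values at z = 0 and z = 1 kill the coefficients of y³ and z y², and x divides the form. -/
theorem conicCubic_eq_zero_of_forall [Infinite k] {a b g c₀ c₁ c₂ c₃ x y : k}
    (hF : (conicCubic a b g c₀ c₁ c₂ c₃).IsHomogeneous 3)
    (hirr : Irreducible (conicCubic a b g c₀ c₁ c₂ c₃))
    (hP : DoubleAt (apexVec k) (conicCubic a b g c₀ c₁ c₂ c₃)) (hxy : x ≠ 0 ∨ y ≠ 0) :
    ¬ ∀ z, eval ![x, y, z] (conicCubic a b g c₀ c₁ c₂ c₃) = 0 := by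
  intro h
  obtain ⟨F', h1, h2, h3, h4, -⟩ := exists_rotation hF hirr hP hxy
  obtain ⟨a', b', g', d₀, d₁, d₂, d₃, rfl⟩ := exists_eq_conicCubic h1 h3
  have e0 := (h4 0).trans (h 0)
  have e1 := (h4 1).trans (h 1)
  simp [eval_conicCubic] at e0 e1
  rw [e0, add_zero] at e1
  refine not_irreducible_X_mul 0 (G := X 2 * (C a' * X 0 + C b' * X 1) +
    (C d₁ * X 1 ^ 2 + C d₂ * (X 0 * X 1) + C d₃ * X 0 ^ 2)) ?_ h1 h2
  simp only [conicCubic, e0, e1, C_0]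
  ring

theorem exists_binary_quadratic_root [IsAlgClosed k] (a b g : k) :
    ∃ x y : k, (x ≠ 0 ∨ y ≠ 0) ∧ a * x ^ 2 + b * (x * y) + g * y ^ 2 = 0 := by
  by_cases hg : g = 0
  · exact ⟨0, 1, Or.inr one_ne_zero, by simp [hg]⟩
  · obtain ⟨y, hy⟩ := IsAlgClosed.exists_root
      (Polynomial.C g * Polynomial.X ^ 2 + Polynomial.C b * Polynomial.X + Polynomial.C a)
      (by rw [Polynomial.degree_quadratic hg]; decide)
    refine ⟨1, y, Or.inl one_ne_zero, ?_⟩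
    simp [Polynomial.IsRoot] at hy
    linear_combination hy

theorem exists_binary_cubic_root [IsAlgClosed k] (c₀ c₁ c₂ c₃ : k) : ∃ x y : k, (x ≠ 0 ∨ y ≠ 0) ∧
    c₀ * y ^ 3 + c₁ * (x * y ^ 2) + c₂ * (x ^ 2 * y) + c₃ * x ^ 3 = 0 := by
  by_cases hg : c₀ = 0
  · exact ⟨0, 1, Or.inr one_ne_zero, by simp [hg]⟩
  · obtain ⟨y, hy⟩ := IsAlgClosed.exists_root
      (Polynomial.C c₀ * Polynomial.X ^ 3 + Polynomial.C c₁ * Polynomial.X ^ 2 +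
        Polynomial.C c₂ * Polynomial.X + Polynomial.C c₃)
      (by rw [Polynomial.degree_cubic hg]; decide)
    refine ⟨1, y, Or.inl one_ne_zero, ?_⟩
    simp [Polynomial.IsRoot] at hy
    linear_combination hy

/-- Normal form of an irreducible singular plane cubic: it suffices to treat the cubics
`z x² + c(x, y)` and `z x y + c(x, y)` with their singular point `(0 : 0 : 1)`. -/
theorem hasTables_of_normalForm [IsAlgClosed k] {t : ℕ}
    (hcusp : ∀ c₀ c₁ c₂ c₃ : k, c₀ ≠ 0 → (conicCubic 1 0 0 c₀ c₁ c₂ c₃).IsHomogeneous 3 →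
      Irreducible (conicCubic 1 0 0 c₀ c₁ c₂ c₃) →
      HasTables (conicCubic 1 0 0 c₀ c₁ c₂ c₃) (apex k) t)
    (hnode : ∀ c₀ c₁ c₂ c₃ : k, c₀ ≠ 0 → c₃ ≠ 0 → (conicCubic 0 1 0 c₀ c₁ c₂ c₃).IsHomogeneous 3 →
      Irreducible (conicCubic 0 1 0 c₀ c₁ c₂ c₃) →
      HasTables (conicCubic 0 1 0 c₀ c₁ c₂ c₃) (apex k) t)
    {F : MvPolynomial (Fin 3) k} (hF : F.IsHomogeneous 3) (hirr : Irreducible F)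
    {P : Plane k} (hP : IsSingularPoint F P) : HasTables F P t := by
  have : Infinite k := IsAlgClosed.instInfinite
  obtain ⟨F₁, hF₁, hirr₁, hP₁, hT₁⟩ := exists_moving_to_apex hF hirr hP
  refine hT₁ t ?_
  clear hT₁ hP hirr hF
  obtain ⟨a, b, g, c₀, c₁, c₂, c₃, rfl⟩ := exists_eq_conicCubic hF₁ hP₁
  obtain ⟨x, y, hxy, hq⟩ := exists_binary_quadratic_root a b g
  obtain ⟨F₂, hF₂, hirr₂, hP₂, he₂, hT₂⟩ := exists_rotation hF₁ hirr₁ hP₁ hxy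
  refine hT₂ t ?_
  clear hT₂
  obtain ⟨a', b', g', d₀, d₁, d₂, d₃, rfl⟩ := exists_eq_conicCubic hF₂ hP₂
  have hg : g' = 0 := by
    -- The difference of the values at z = 1 and z = 0 isolates the quadratic part, which vanishes
    -- at the chosen root.
    have e0 := he₂ 0
    have e1 := he₂ 1
    simp [eval_conicCubic] at e0 e1
    linear_combination e1 - e0 + hq
  clear he₂
  subst hg
  have hd₀ : d₀ ≠ 0 := by
    rintro rfl
    exact conicCubic_eq_zero_of_forall hF₂ hirr₂ hP₂ (x := 0) (y := 1) (Or.inr one_ne_zero)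
      (by simp [eval_conicCubic])
  by_cases hb : b' = 0
  · subst hb
    have ha : a' ≠ 0 := by
      rintro rfl
      obtain ⟨x, y, hxy, hc⟩ := exists_binary_cubic_root d₀ d₁ d₂ d₃
      exact conicCubic_eq_zero_of_forall hF₂ hirr₂ hP₂ hxy (by simpa [eval_conicCubic] using hc)
    obtain ⟨F₃, hF₃, hirr₃, -, he₃, hT₃⟩ := linSubst_data hF₂ hirr₂
      !![1, 0, 0; 0, 1, 0; 0, 0, a'⁻¹]
      (by simpa [Matrix.det_fin_three] using ha) apexVec_ne_zero (s := a'⁻¹)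
      (by rw [mulVec_of_fin_three]; simp [apexVec]) hP₂
    refine hT₃ t ?_
    have : F₃ = conicCubic 1 0 0 d₀ d₁ d₂ d₃ := by
      refine MvPolynomial.funext fun v => ?_
      rw [he₃, eval_conicCubic, eval_conicCubic, mulVec_of_fin_three]
      simp
      field_simp
    subst this
    exact hcusp d₀ d₁ d₂ d₃ hd₀ hF₃ hirr₃
  -- The substitution y ↦ (y - a' x) / b' turns the quadratic part x (a' x + b' y) into x y.
  · obtain ⟨F₃, hF₃, hirr₃, hP₃, he₃, hT₃⟩ := linSubst_data hF₂ hirr₂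
      !![1, 0, 0; -a' * b'⁻¹, b'⁻¹, 0; 0, 0, 1]
      (by simpa [Matrix.det_fin_three] using hb) apexVec_ne_zero (s := 1)
      (by rw [mulVec_of_fin_three]; simp [apexVec]) hP₂
    refine hT₃ t ?_
    have : F₃ = conicCubic 0 1 0 (d₀ / b' ^ 3) (d₁ / b' ^ 2 - 3 * a' * d₀ / b' ^ 3)
        (d₂ / b' - 2 * a' * d₁ / b' ^ 2 + 3 * a' ^ 2 * d₀ / b' ^ 3)
        (d₃ - a' * d₂ / b' + a' ^ 2 * d₁ / b' ^ 2 - a' ^ 3 * d₀ / b' ^ 3) := by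
      refine MvPolynomial.funext fun v => ?_
      rw [he₃, eval_conicCubic, eval_conicCubic, mulVec_of_fin_three]
      simp
      field_simp
      ring
    subst this
    refine hnode _ _ _ _ (by positivity) ?_ hF₃ hirr₃
    intro h
    refine conicCubic_eq_zero_of_forall hF₃ hirr₃ hP₃ (x := 1) (y := 0) (Or.inl one_ne_zero) ?_
    rw [h]
    simp [eval_conicCubic]

end NormalForm

end FatPoints

namespace FatPoints

open Polynomial

/-! ### Dimension counts for images and kernels -/

section LinearAlgebra

variable {k : Type*} [Field k]

theorem finrank_map_of_injOn {V W : Type*} [AddCommGroup V] [Module k V] [AddCommGroup W]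
    [Module k W] (f : V →ₗ[k] W) (p : Submodule k V) (hf : ∀ x ∈ p, f x = 0 → x = 0) :
    Module.finrank k (p.map f) = Module.finrank k p := by
  rw [← LinearMap.range_domRestrict]
  refine (LinearEquiv.ofInjective (f.domRestrict p) ?_).finrank_eq.symm
  rw [← LinearMap.ker_eq_bot, LinearMap.ker_eq_bot']
  rintro ⟨x, hx⟩ h
  exact Subtype.ext (hf x hx h)

theorem finrank_map_add_finrank_inf_ker {V W : Type*} [AddCommGroup V] [Module k V]
    [AddCommGroup W] [Module k W] (f : V →ₗ[k] W) (p : Submodule k V) [FiniteDimensional k p] :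
    Module.finrank k (p.map f) + Module.finrank k (p ⊓ LinearMap.ker f : Submodule k V) =
      Module.finrank k p := by
  rw [← LinearMap.finrank_range_add_finrank_ker (f.domRestrict p), LinearMap.range_domRestrict]
  congr 1
  have : (p ⊓ LinearMap.ker f : Submodule k V) =
      (LinearMap.ker (f.domRestrict p)).map p.subtype := by
    ext x
    simp [and_comm]
  rw [this, finrank_map_of_injOn]
  intro x _ hx
  exact Subtype.ext hx

theorem finrank_inf_ker_add_one {V : Type*} [AddCommGroup V] [Module k V]
    (f : V →ₗ[k] k) (p : Submodule k V) [FiniteDimensional k p] {x : V} (hx : x ∈ p)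
    (hfx : f x ≠ 0) :
    Module.finrank k (p ⊓ LinearMap.ker f : Submodule k V) + 1 = Module.finrank k p := by
  rw [← finrank_map_add_finrank_inf_ker f p, add_comm]
  congr 1
  have : p.map f = ⊤ := by
    rw [eq_top_iff]
    intro y _
    refine ⟨(y / f x) • x, p.smul_mem _ hx, ?_⟩
    simp [hfx]
  rw [this, finrank_top, Module.finrank_self]

end LinearAlgebra

/-! ### Pullbacks of forms and the gluing condition at P -/

section Univariate

variable {k : Type*} [Field k]

theorem finrank_degreeLT (n : ℕ) : Module.finrank k (degreeLT k n) = n := by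
  rw [(degreeLTEquiv k n).finrank_eq, Module.finrank_fin_fun]

theorem mem_degreeLT_succ {n : ℕ} {f : k[X]} : f ∈ degreeLT k (n + 1) ↔ f.natDegree ≤ n := by
  rw [degreeLT_succ_eq_degreeLE, mem_degreeLE, natDegree_le_iff_degree_le]

theorem mem_degreeLT_iff_coeff {n : ℕ} {f : k[X]} :
    f ∈ degreeLT k n ↔ ∀ i, n ≤ i → f.coeff i = 0 := by
  rw [mem_degreeLT, degree_lt_iff_coeff_zero]

theorem mul_mem_degreeLT {f g : k[X]} {m n N : ℕ} (hf : f.natDegree ≤ m) (hg : g ∈ degreeLT k n)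
    (hN : m + n ≤ N) : f * g ∈ degreeLT k N := by
  rcases eq_or_ne g 0 with rfl | h
  · simp
  rw [mem_degreeLT, degree_eq_natDegree h, Nat.cast_lt] at hg
  rw [mem_degreeLT]
  refine lt_of_le_of_lt degree_le_natDegree (Nat.cast_lt.2 ?_)
  have := natDegree_mul_le (p := f) (q := g)
  omega

theorem eq_zero_of_mul_mem_degreeLT {f g : k[X]} {m n N : ℕ} (hf : f.natDegree = m) (hf0 : f ≠ 0)
    (hN : N ≤ m + n) (h : f * g ∈ degreeLT k N) : g ∈ degreeLT k n := by
  rcases eq_or_ne g 0 with rfl | hg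
  · simp
  rw [mem_degreeLT, degree_eq_natDegree (mul_ne_zero hf0 hg), Nat.cast_lt,
    natDegree_mul hf0 hg] at h
  rw [mem_degreeLT, degree_eq_natDegree hg, Nat.cast_lt]
  omega

theorem exists_sub_C_mul_mem_degreeLT {f h : k[X]} {n : ℕ} (hf : f ∈ degreeLT k (n + 1))
    (hh : h.natDegree = n) (h0 : h ≠ 0) : ∃ a, f - C a * h ∈ degreeLT k n := by
  have hl : h.coeff n ≠ 0 := by
    rw [← hh]
    exact leadingCoeff_ne_zero.2 h0
  refine ⟨f.coeff n / h.coeff n, mem_degreeLT_iff_coeff.2 fun i hi => ?_⟩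
  rw [coeff_sub, coeff_C_mul]
  rcases hi.eq_or_lt with rfl | hi
  · rw [div_mul_cancel₀ _ hl, sub_self]
  · rw [mem_degreeLT_iff_coeff.1 hf i hi, coeff_eq_zero_of_natDegree_lt (hh.trans_lt hi)]
    simp

theorem exists_eq_X_mul {f : k[X]} {n : ℕ} (hf : f ∈ degreeLT k (n + 1)) (h0 : f.coeff 0 = 0) :
    ∃ g ∈ degreeLT k n, f = X * g := by
  obtain ⟨g, rfl⟩ := X_dvd_iff.2 h0
  exact ⟨g, eq_zero_of_mul_mem_degreeLT natDegree_X X_ne_zero (by omega) hf, rfl⟩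

/-- The polynomials `q`, `c` of a parametrization `u ↦ (q : u q : -c)` of a nodal or cuspidal
cubic: `q = X` for a node, and `q = 1` for a cusp. -/
structure IsParam (q c : k[X]) : Prop where
  natDegree_c : c.natDegree = 3
  cases : q = 1 ∨ q = X ∧ c.coeff 0 ≠ 0

/-- The polynomials `a c ^ d + q g`, with `g` of degree at most `3 d - 2`. They are the pullbacks
of the forms of degree `d` under the parametrization. -/
noncomputable def curveForms (q c : k[X]) (d : ℕ) : Submodule k k[X] :=
  Submodule.span k {c ^ d} ⊔ (degreeLT k (3 * d - 1)).map (LinearMap.mulLeft k q)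

theorem mem_curveForms {q c f : k[X]} {d : ℕ} :
    f ∈ curveForms q c d ↔ ∃ a, ∃ g ∈ degreeLT k (3 * d - 1), f = C a * c ^ d + q * g := by
  simp only [curveForms, Submodule.mem_sup, Submodule.mem_span_singleton, Submodule.mem_map]
  constructor
  · rintro ⟨_, ⟨a, rfl⟩, _, ⟨g, hg, rfl⟩, rfl⟩
    exact ⟨a, g, hg, by rw [smul_eq_C_mul, LinearMap.mulLeft_apply]⟩
  · rintro ⟨a, g, hg, rfl⟩
    exact ⟨_, ⟨a, rfl⟩, _, ⟨g, hg, rfl⟩, by rw [smul_eq_C_mul, LinearMap.mulLeft_apply]⟩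

theorem one_ne_X : (1 : k[X]) ≠ X := fun h => by
  simpa using congrArg natDegree h

/-- The exponent of the second monomial entering the gluing condition of the singular point. -/
noncomputable def pivot (q : k[X]) (d : ℕ) : ℕ := open Classical in if q = X then 0 else 3 * d - 1

/-- The gluing condition at the singular point. -/
noncomputable def gluing (q c : k[X]) (d : ℕ) : k[X] →ₗ[k] k :=
  (c ^ d).coeff (3 * d) • lcoeff k (pivot q d) - (c ^ d).coeff (pivot q d) • lcoeff k (3 * d)

theorem gluing_apply (q c f : k[X]) (d : ℕ) : gluing q c d f =
    (c ^ d).coeff (3 * d) * f.coeff (pivot q d) - (c ^ d).coeff (pivot q d) * f.coeff (3 * d) := by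
  simp [gluing]

namespace IsParam

variable {q c : k[X]} (h : IsParam q c)
include h

theorem c_ne_zero : c ≠ 0 := by
  intro h0
  have := h.natDegree_c
  simp [h0] at this

theorem q_ne_zero : q ≠ 0 := by
  rcases h.cases with rfl | ⟨rfl, -⟩
  · exact one_ne_zero
  · exact X_ne_zero

theorem natDegree_q_le : q.natDegree ≤ 1 := by
  rcases h.cases with rfl | ⟨rfl, -⟩
  · simp
  · simp

theorem natDegree_c_pow (d : ℕ) : (c ^ d).natDegree = 3 * d := by
  rw [natDegree_pow, h.natDegree_c, mul_comm]

theorem coeff_c_pow_ne_zero (d : ℕ) : (c ^ d).coeff (3 * d) ≠ 0 := by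
  rw [← h.natDegree_c_pow]
  exact leadingCoeff_ne_zero.2 (pow_ne_zero _ h.c_ne_zero)

theorem curveForms_le (d : ℕ) : curveForms q c d ≤ degreeLT k (3 * d + 1) := by
  intro f hf
  obtain ⟨a, g, hg, rfl⟩ := mem_curveForms.1 hf
  refine add_mem ?_ (mul_mem_degreeLT h.natDegree_q_le hg (by omega))
  rw [← smul_eq_C_mul]
  refine Submodule.smul_mem _ _ (mem_degreeLT_succ.2 (h.natDegree_c_pow d).le)

/-- The multiples of q absorb every exponent up to 3d except two, 3d and `pivot q d`. So membership
says that these two coefficients are proportional to those of c^d. For a node this ties the values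
at the branches u = 0 and u = ∞; for a cusp it ties the first order term at u = ∞ to the value
there. -/
theorem mem_curveForms_iff_gluing {d : ℕ} (hd : d ≠ 0) {f : k[X]} :
    f ∈ curveForms q c d ↔ f ∈ degreeLT k (3 * d + 1) ∧ gluing q c d f = 0 := by
  constructor
  · intro hf
    refine ⟨h.curveForms_le d hf, ?_⟩
    obtain ⟨a, g, hg, rfl⟩ := mem_curveForms.1 hf
    have h1 : gluing q c d (C a * c ^ d) = 0 := by
      rw [gluing_apply, coeff_C_mul, coeff_C_mul]
      ring
    rw [map_add, h1, zero_add, gluing_apply]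
    have h2 : (q * g).coeff (3 * d) = 0 :=
      mem_degreeLT_iff_coeff.1 (mul_mem_degreeLT h.natDegree_q_le hg (by omega)) (3 * d) le_rfl
    have h3 : (q * g).coeff (pivot q d) = 0 := by
      rcases h.cases with rfl | ⟨rfl, -⟩
      · rw [pivot, if_neg one_ne_X, one_mul]
        exact mem_degreeLT_iff_coeff.1 hg _ le_rfl
      · rw [pivot, if_pos rfl, coeff_X_mul_zero]
    rw [h2, h3]
    ring
  · rintro ⟨hf, hg⟩
    obtain ⟨a, ha⟩ := exists_sub_C_mul_mem_degreeLT hf (h.natDegree_c_pow d)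
      (pow_ne_zero _ h.c_ne_zero)
    set r := f - C a * c ^ d with hr
    have h1 : r.coeff (3 * d) = 0 := mem_degreeLT_iff_coeff.1 ha _ le_rfl
    have h2 : r.coeff (pivot q d) = 0 := by
      have : gluing q c d r = 0 := by
        rw [hr, map_sub, hg, gluing_apply, coeff_C_mul, coeff_C_mul]
        ring
      rw [gluing_apply, h1, mul_zero, sub_zero] at this
      exact (mul_eq_zero.1 this).resolve_left (h.coeff_c_pow_ne_zero d)
    rw [mem_curveForms]
    rcases h.cases with rfl | ⟨rfl, -⟩
    · refine ⟨a, r, mem_degreeLT_iff_coeff.2 fun i hi => ?_, by rw [hr]; ring⟩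
      rw [pivot, if_neg one_ne_X] at h2
      rcases hi.eq_or_lt with rfl | hi
      · exact h2
      · exact mem_degreeLT_iff_coeff.1 ha i (by omega)
    · rw [pivot, if_pos rfl] at h2
      obtain ⟨g, hg', hrg⟩ := exists_eq_X_mul (n := 3 * d - 1)
        (by rwa [Nat.sub_add_cancel (by omega)]) h2
      exact ⟨a, g, hg', by rw [← hrg, hr]; ring⟩

/-- This is the inductive step for lifting q g to a form of degree d + 1: the first summand, times
q, comes from (α x + β y)(-z)^d, and q² s is x or y times forms lifted in degree d. Subtracting
multiples of X c^d and c^d clears the top coefficient and then either the next one (cusp) or the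
constant one (node). -/
theorem exists_decomposition {d : ℕ} {g : k[X]} (hg : g ∈ degreeLT k (3 * d + 2)) :
    ∃ α β, ∃ s ∈ degreeLT k (3 * d), g = (C α + C β * X) * c ^ d + q * s := by
  have hX : (X * c ^ d).natDegree = 3 * d + 1 := by
    rw [natDegree_X_mul (pow_ne_zero _ h.c_ne_zero), h.natDegree_c_pow]
  obtain ⟨β, hβ⟩ := exists_sub_C_mul_mem_degreeLT hg hX
    (mul_ne_zero X_ne_zero (pow_ne_zero _ h.c_ne_zero))
  rcases h.cases with rfl | ⟨rfl, h0⟩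
  · obtain ⟨α, hα⟩ := exists_sub_C_mul_mem_degreeLT hβ (h.natDegree_c_pow d)
      (pow_ne_zero _ h.c_ne_zero)
    exact ⟨α, β, _, hα, by ring⟩
  · set r := g - C β * (X * c ^ d) with hr
    have h0' : (c ^ d).coeff 0 ≠ 0 := by
      rw [coeff_zero_eq_eval_zero, eval_pow, ← coeff_zero_eq_eval_zero]
      exact pow_ne_zero _ h0
    obtain ⟨s, hs, hrs⟩ := exists_eq_X_mul (n := 3 * d)
      (f := r - C (r.coeff 0 / (c ^ d).coeff 0) * c ^ d) (by
        refine sub_mem hβ ?_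
        rw [← smul_eq_C_mul]
        exact Submodule.smul_mem _ _ (mem_degreeLT_succ.2 (h.natDegree_c_pow d).le)) (by
        rw [coeff_sub, coeff_C_mul, div_mul_cancel₀ _ h0', sub_self])
    refine ⟨r.coeff 0 / (c ^ d).coeff 0, β, s, hs, ?_⟩
    rw [← hrs, hr]
    ring

end IsParam

end Univariate

/-! ### Pullbacks divisible by a given polynomial -/

section Dimension

variable {k : Type*} [Field k] {q c : k[X]}

instance (d : ℕ) : FiniteDimensional k (curveForms q c d) := by
  rw [curveForms]
  infer_instance

/-- The pulled back forms of degree `d` that are divisible by `L`. -/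
noncomputable def curveFormsThrough (q c L : k[X]) (d : ℕ) : Submodule k k[X] :=
  curveForms q c d ⊓ LinearMap.range (LinearMap.mulLeft k L)

theorem mem_curveFormsThrough {L f : k[X]} {d : ℕ} :
    f ∈ curveFormsThrough q c L d ↔ f ∈ curveForms q c d ∧ L ∣ f := by
  simp only [curveFormsThrough, Submodule.mem_inf, LinearMap.mem_range, LinearMap.mulLeft_apply,
    dvd_def, eq_comm]

namespace IsParam

variable (h : IsParam q c) {L : k[X]} (hL : L ≠ 0) {n : ℕ} (hn : L.natDegree = n)
include h hL hn

theorem curveFormsThrough_eq_bot {d : ℕ} (hd : 3 * d < n) : curveFormsThrough q c L d = ⊥ := by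
  rw [eq_bot_iff]
  intro f hf
  obtain ⟨hf, g, rfl⟩ := mem_curveFormsThrough.1 hf
  have := eq_zero_of_mul_mem_degreeLT (n := 0) hn hL (by omega) (h.curveForms_le d hf)
  rw [mem_degreeLT_iff_coeff] at this
  have : g = 0 := Polynomial.ext fun i => by simpa using this i (Nat.zero_le _)
  simp [this]

/-- Division by L leaves polynomials of degree at most 3d - n subject to the gluing condition, a
single linear equation that may or may not be trivial. -/
theorem finrank_curveFormsThrough_eq {d : ℕ} (hd : d ≠ 0) (hdn : n ≤ 3 * d) :
    Module.finrank k (curveFormsThrough q c L d) =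
      Module.finrank k (degreeLT k (3 * d - n + 1) ⊓
        LinearMap.ker (gluing q c d ∘ₗ LinearMap.mulLeft k L) : Submodule k k[X]) := by
  have : curveFormsThrough q c L d = (degreeLT k (3 * d - n + 1) ⊓
      LinearMap.ker (gluing q c d ∘ₗ LinearMap.mulLeft k L) : Submodule k k[X]).map
        (LinearMap.mulLeft k L) := by
    ext f
    rw [mem_curveFormsThrough, h.mem_curveForms_iff_gluing hd, Submodule.mem_map]
    constructor
    · rintro ⟨⟨h1, h2⟩, g, rfl⟩
      exact ⟨g, ⟨eq_zero_of_mul_mem_degreeLT hn hL (by omega) h1, h2⟩, rfl⟩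
    · rintro ⟨g, ⟨h1, h2⟩, rfl⟩
      exact ⟨⟨mul_mem_degreeLT hn.le h1 (by omega), h2⟩, g, rfl⟩
  rw [this, finrank_map_of_injOn]
  intro x _ hx
  exact (mul_eq_zero.1 hx).resolve_left hL

theorem finrank_curveFormsThrough_of_lt {d : ℕ} (hdn : n < 3 * d)
    (hq : q = X → L.coeff 0 ≠ 0) :
    Module.finrank k (curveFormsThrough q c L d) = 3 * d - n := by
  have hd : d ≠ 0 := by omega
  rw [h.finrank_curveFormsThrough_eq hL hn hd hdn.le]
  -- The equation is nontrivial. For a cusp a power of X moves the leading coefficient of L to the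
  -- exponent 3d - 1; for a node 1 works, since L(0) ≠ 0 and deg L < 3d.
  have key : ∃ x ∈ degreeLT k (3 * d - n + 1), gluing q c d (L * x) ≠ 0 := by
    rcases h.cases with rfl | ⟨rfl, -⟩
    · refine ⟨X ^ (3 * d - n - 1), mem_degreeLT_succ.2 (by simp), ?_⟩
      rw [gluing_apply, pivot, if_neg one_ne_X]
      have h1 : (L * X ^ (3 * d - n - 1)).coeff (3 * d - 1) = L.leadingCoeff := by
        rw [show 3 * d - 1 = n + (3 * d - n - 1) by omega, coeff_mul_X_pow, leadingCoeff, hn]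
      have h2 : (L * X ^ (3 * d - n - 1)).coeff (3 * d) = 0 := by
        apply coeff_eq_zero_of_natDegree_lt
        rw [natDegree_mul_X_pow _ hL]
        omega
      rw [h1, h2, mul_zero, sub_zero]
      exact mul_ne_zero (h.coeff_c_pow_ne_zero d) (leadingCoeff_ne_zero.2 hL)
    · refine ⟨1, mem_degreeLT_succ.2 (by simp), ?_⟩
      rw [gluing_apply, pivot, if_pos rfl, mul_one, coeff_eq_zero_of_natDegree_lt (hn.trans_lt hdn),
        mul_zero, sub_zero]
      exact mul_ne_zero (h.coeff_c_pow_ne_zero d) (hq rfl)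
  obtain ⟨x, hx, hgx⟩ := key
  have := finrank_inf_ker_add_one (gluing q c d ∘ₗ LinearMap.mulLeft k L) _ hx hgx
  rw [finrank_degreeLT] at this
  omega

/-- When deg L = 3d only the constant multiples of L are candidates, so everything depends on
whether L satisfies the gluing condition. -/
theorem finrank_curveFormsThrough_of_gluing_ne {d : ℕ} (hd : d ≠ 0) (hdn : n = 3 * d)
    (hg : gluing q c d L ≠ 0) : Module.finrank k (curveFormsThrough q c L d) = 0 := by
  rw [h.finrank_curveFormsThrough_eq hL hn hd hdn.le]
  have := finrank_inf_ker_add_one (gluing q c d ∘ₗ LinearMap.mulLeft k L)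
    (degreeLT k (3 * d - n + 1)) (x := 1) (mem_degreeLT_succ.2 (by simp)) (by simpa using hg)
  rw [finrank_degreeLT] at this
  omega

theorem finrank_curveFormsThrough_of_gluing_eq {d : ℕ} (hd : d ≠ 0) (hdn : n = 3 * d)
    (hg : gluing q c d L = 0) : Module.finrank k (curveFormsThrough q c L d) = 1 := by
  rw [h.finrank_curveFormsThrough_eq hL hn hd hdn.le]
  have : degreeLT k (3 * d - n + 1) ≤
      LinearMap.ker (gluing q c d ∘ₗ LinearMap.mulLeft k L) := by
    intro f hf
    rw [hdn, Nat.sub_self, mem_degreeLT_succ, natDegree_le_iff_degree_le] at hf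
    rw [eq_C_of_degree_le_zero hf]
    simp [mul_comm L, ← smul_eq_C_mul, hg]
  rw [inf_eq_left.2 this, finrank_degreeLT]
  omega

end IsParam

theorem IsParam.finrank_curveForms (h : IsParam q c) {d : ℕ} (hd : d ≠ 0) :
    Module.finrank k (curveForms q c d) = 3 * d := by
  have := h.finrank_curveFormsThrough_of_lt (L := 1) one_ne_zero natDegree_one (d := d)
    (by omega) (by simp)
  have h1 : curveFormsThrough q c 1 d = curveForms q c d := by
    ext f
    simp [mem_curveFormsThrough]
  rwa [h1, Nat.sub_zero] at this

/-- Degree 0 departs from the value 3d: the truncated 3 * 0 - 1 is 0, and only the constants remain.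
-/
theorem IsParam.finrank_curveForms_zero (_h : IsParam q c) :
    Module.finrank k (curveForms q c 0) = 1 := by
  have : degreeLT k (3 * 0 - 1) = ⊥ := by
    rw [← Submodule.finrank_eq_zero, finrank_degreeLT]
  rw [curveForms, this, Submodule.map_bot, sup_bot_eq]
  exact finrank_span_singleton (by simp)

end Dimension

end FatPoints

namespace FatPoints

open MvPolynomial
open scoped Polynomial

/-! ### Forms on the parametrized cubic, and singularity at its points -/

section Parametrization

variable {k : Type*} [Field k]

/-- The pullback of forms under `u ↦ (q : u q : -c)`. -/
noncomputable def param (q c : k[X]) : MvPolynomial (Fin 3) k →ₐ[k] k[X] :=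
  aeval ![q, Polynomial.X * q, -c]

/-- The point `(q(u), u q(u), -c(u))`. -/
noncomputable def curveVec (q c : k[X]) (u : k) : Fin 3 → k :=
  ![q.eval u, u * q.eval u, -c.eval u]

variable {q c : k[X]}

theorem curveVec_zero (u : k) : curveVec q c u 0 = q.eval u := rfl
theorem curveVec_one (u : k) : curveVec q c u 1 = u * q.eval u := rfl

@[simp] theorem param_X_zero : param q c (X 0) = q := by simp [param]
@[simp] theorem param_X_one : param q c (X 1) = Polynomial.X * q := by simp [param]
@[simp] theorem param_X_two : param q c (X 2) = -c := by simp [param]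
@[simp] theorem param_C (a : k) : param q c (C a) = Polynomial.C a := by
  simp [param, Polynomial.algebraMap_eq]

theorem eval_param (u : k) (G : MvPolynomial (Fin 3) k) :
    (param q c G).eval u = eval (curveVec q c u) G := by
  induction G using MvPolynomial.induction_on with
  | C a => simp
  | add p r hp hr => rw [map_add, Polynomial.eval_add, hp, hr, map_add]
  | mul_X p n hp =>
    rw [map_mul, Polynomial.eval_mul, hp, map_mul, eval_X]
    congr 1
    fin_cases n <;> simp [curveVec]

theorem derivative_param (G : MvPolynomial (Fin 3) k) :
    (param q c G).derivative = param q c (pderiv 0 G) * q.derivative +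
      param q c (pderiv 1 G) * (Polynomial.X * q).derivative +
      param q c (pderiv 2 G) * (-c).derivative := by
  induction G using MvPolynomial.induction_on with
  | C a => simp
  | add p r hp hr =>
    simp only [map_add, hp, hr]
    ring
  | mul_X p n hp =>
    rw [map_mul, Polynomial.derivative_mul, hp]
    simp only [pderiv_mul, map_add, map_mul, pderiv_X]
    fin_cases n <;> simp <;> ring

theorem euler_eval {d : ℕ} {G : MvPolynomial (Fin 3) k} (hG : G.IsHomogeneous d)
    {v : Fin 3 → k} (h : eval v G = 0) :
    v 0 * eval v (pderiv 0 G) + v 1 * eval v (pderiv 1 G) + v 2 * eval v (pderiv 2 G) = 0 := by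
  have := congrArg (eval v) hG.sum_X_mul_pderiv
  simpa [Fin.sum_univ_three, h] using this

/-- Singularity at a smooth point of the curve, in terms of the parametrization. -/
theorem doubleAt_curveVec_iff {d : ℕ} {G : MvPolynomial (Fin 3) k} (hG : G.IsHomogeneous d)
    {u : k} (hu : q.eval u ≠ 0) : DoubleAt (curveVec q c u) G ↔
      (param q c G).eval u = 0 ∧ (param q c G).derivative.eval u = 0 ∧
      eval (curveVec q c u) (pderiv 2 G) = 0 := by
  rw [eval_param, derivative_param]
  simp only [Polynomial.eval_add, Polynomial.eval_mul, eval_param]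
  constructor
  · rintro ⟨h0, h1⟩
    exact ⟨h0, by rw [h1 0, h1 1, h1 2]; ring, h1 2⟩
  · rintro ⟨h0, h1, h2⟩
    have he := euler_eval hG h0
    rw [h2] at h1 he
    simp only [curveVec_zero, curveVec_one, zero_mul, mul_zero, add_zero,
      Polynomial.derivative_mul, Polynomial.derivative_X, Polynomial.eval_add, Polynomial.eval_mul,
      Polynomial.eval_X, one_mul] at h1 he
    have e1 : eval (curveVec q c u) (pderiv 1 G) = 0 := by
      -- The chain rule and Euler's relation are two linear equations for the partials ∂₀G and ∂₁G,
      -- with determinant -q(u)².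
      refine (mul_eq_zero.1 (?_ : q.eval u ^ 2 * _ = 0)).resolve_left (pow_ne_zero 2 hu)
      linear_combination q.eval u * h1 - q.derivative.eval u * he
    have e0 : eval (curveVec q c u) (pderiv 0 G) = 0 := by
      refine (mul_eq_zero.1 (?_ : q.eval u * _ = 0)).resolve_left hu
      linear_combination he - u * q.eval u * e1
    refine ⟨h0, fun i => ?_⟩
    fin_cases i
    · exact e0
    · exact e1
    · exact h2

namespace IsParam

variable (h : IsParam q c)
include h

theorem param_mem_curveForms {d : ℕ} {G : MvPolynomial (Fin 3) k} (hG : G.IsHomogeneous d) :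
    param q c G ∈ curveForms q c d := by
  refine homogeneous_induction (p := fun d G => param q c G ∈ curveForms q c d) ?_ ?_ ?_ hG
  · intro a
    exact mem_curveForms.2 ⟨a, 0, zero_mem _, by simp⟩
  · intro d G H h1 h2
    rw [map_add]
    exact add_mem h1 h2
  · intro d i G _ hd
    have hlt := h.curveForms_le d hd
    rw [map_mul]
    fin_cases i
    · refine mem_curveForms.2 ⟨0, param q c G, Polynomial.degreeLT_mono (by omega) hlt, by simp⟩
    · refine mem_curveForms.2 ⟨0, Polynomial.X * param q c G,
        mul_mem_degreeLT Polynomial.natDegree_X_le hlt (by omega), by simp; ring⟩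
    · obtain ⟨a, g, hg, hf⟩ := mem_curveForms.1 hd
      refine mem_curveForms.2 ⟨-a, -c * g, ?_, ?_⟩
      -- For d = 0 the bound 3 + (3d - 1) ≤ 3(d + 1) - 1 fails because of truncation, but then g =
      -- 0.
      · rcases Nat.eq_zero_or_pos d with rfl | hpos
        · have : g = 0 := by
            rw [mem_degreeLT_iff_coeff] at hg
            exact Polynomial.ext fun i => by simpa using hg i (Nat.zero_le _)
          simp [this]
        · exact mul_mem_degreeLT (m := 3) (by rw [Polynomial.natDegree_neg, h.natDegree_c]) hg
            (by omega)
      · simp [hf]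
        ring

/-- The power c^d comes from (-z)^d. The multiples of q are lifted by induction on the degree:
`exists_decomposition` splits off (α x + β y)(-z)^d, and writing the remainder as s = s₀ + X s₁
gives q² s = q · (q s₀) + X q · (q s₁), the pullback of x G₀ + y G₁. -/
theorem exists_param_eq {d : ℕ} {f : k[X]} (hf : f ∈ curveForms q c d) :
    ∃ G : MvPolynomial (Fin 3) k, G.IsHomogeneous d ∧ param q c G = f := by
  have hpow : ∀ d : ℕ, ((-X 2) ^ d : MvPolynomial (Fin 3) k).IsHomogeneous d := fun d => by
    simpa using ((isHomogeneous_X k (2 : Fin 3)).neg).pow d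
  have hcpow : ∀ d : ℕ, param q c ((-X 2) ^ d) = c ^ d := fun d => by simp
  have key : ∀ d : ℕ, ∀ g ∈ Polynomial.degreeLT k (3 * d - 1),
      ∃ G : MvPolynomial (Fin 3) k, G.IsHomogeneous d ∧ param q c G = q * g := by
    intro d
    induction d with
    | zero =>
      intro g hg
      have : g = 0 := by
        rw [mem_degreeLT_iff_coeff] at hg
        exact Polynomial.ext fun i => by simpa using hg i (Nat.zero_le _)
      exact ⟨0, isHomogeneous_zero _ _ _, by simp [this]⟩
    | succ d ih =>
      intro g hg
      obtain ⟨α, β, s, hs, rfl⟩ := h.exists_decomposition (d := d) (g := g) (by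
        convert hg using 2
        omega)
      have hs' : ∃ s₀ ∈ Polynomial.degreeLT k (3 * d - 1), ∃ s₁ ∈ Polynomial.degreeLT k (3 * d - 1),
          s = s₀ + Polynomial.X * s₁ := by
        rcases Nat.eq_zero_or_pos d with rfl | hpos
        · have : s = 0 := by
            rw [mem_degreeLT_iff_coeff] at hs
            exact Polynomial.ext fun i => by simpa using hs i (Nat.zero_le _)
          exact ⟨0, zero_mem _, 0, zero_mem _, by simp [this]⟩
        · have hC : Polynomial.C (s.coeff 0) ∈ Polynomial.degreeLT k (3 * d - 1) :=
            Polynomial.degreeLT_mono (by omega : 0 + 1 ≤ 3 * d - 1)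
              (mem_degreeLT_succ.2 (Polynomial.natDegree_C _).le)
          obtain ⟨s₁, hs₁, he⟩ := exists_eq_X_mul (n := 3 * d - 1)
            (f := s - Polynomial.C (s.coeff 0)) (by
              rw [Nat.sub_add_cancel (by omega)]
              exact sub_mem hs (Polynomial.degreeLT_mono (by omega) hC)) (by simp)
          exact ⟨_, hC, s₁, hs₁, by rw [← he]; ring⟩
      obtain ⟨s₀, hs₀, s₁, hs₁, rfl⟩ := hs'
      obtain ⟨G₀, hG₀, e₀⟩ := ih s₀ hs₀
      obtain ⟨G₁, hG₁, e₁⟩ := ih s₁ hs₁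
      refine ⟨(-X 2) ^ d * (C α * X 0 + C β * X 1) + (G₀ * X 0 + G₁ * X 1), ?_, ?_⟩
      · exact ((hpow d).mul ((isHomogeneous_C_mul_X _ _).add (isHomogeneous_C_mul_X _ _))).add
          ((hG₀.mul (isHomogeneous_X _ _)).add (hG₁.mul (isHomogeneous_X _ _)))
      · rw [map_add, map_mul, hcpow]
        simp only [map_add, map_mul, param_C, param_X_zero, param_X_one, e₀, e₁]
        ring
  obtain ⟨a, g, hg, rfl⟩ := mem_curveForms.1 hf
  obtain ⟨G, hG, e⟩ := key d g hg
  refine ⟨C a * (-X 2) ^ d + G, ((hpow d).C_mul a).add hG, ?_⟩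
  rw [map_add, map_mul, hcpow, e, param_C]

/-- This is the pullback of the expansion of G at (0 : 0 : 1): the z^d and z^(d-1) terms, plus an
element of (x, y)², which is divisible by q². The degree bound on r records vanishing at u = ∞. -/
theorem apex_expansion {d : ℕ} {G : MvPolynomial (Fin 3) k} (hG : G.IsHomogeneous d) :
    ∃ r ∈ Polynomial.degreeLT k (3 * d - 3),
      param q c G = Polynomial.C (eval (apexVec k) G) * (-c) ^ d +
        (-c) ^ (d - 1) * q * (Polynomial.C (eval (apexVec k) (pderiv 0 G)) +
          Polynomial.C (eval (apexVec k) (pderiv 1 G)) * Polynomial.X) + q ^ 2 * r := by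
  refine homogeneous_induction (p := fun d G => ∃ r ∈ Polynomial.degreeLT k (3 * d - 3),
      param q c G = Polynomial.C (eval (apexVec k) G) * (-c) ^ d +
        (-c) ^ (d - 1) * q * (Polynomial.C (eval (apexVec k) (pderiv 0 G)) +
          Polynomial.C (eval (apexVec k) (pderiv 1 G)) * Polynomial.X) + q ^ 2 * r) ?_ ?_ ?_ hG
  · intro a
    exact ⟨0, zero_mem _, by simp⟩
  · rintro d G H ⟨r, hr, h1⟩ ⟨s, hs, h2⟩
    refine ⟨r + s, add_mem hr hs, ?_⟩
    rw [map_add, h1, h2]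
    simp only [map_add]
    ring
  · rintro d i G hG ⟨r, hr, hd⟩
    rcases d with _ | d
    · obtain ⟨a, rfl⟩ := exists_eq_C hG
      refine ⟨0, zero_mem _, ?_⟩
      fin_cases i <;> simp [apexVec, pderiv_X] <;> ring
    · set α := eval (apexVec k) (pderiv 0 G) with hα
      set β := eval (apexVec k) (pderiv 1 G) with hβ
      have hlin : (Polynomial.C α + Polynomial.C β * Polynomial.X).natDegree ≤ 1 := by
        rw [add_comm]
        exact Polynomial.natDegree_linear_le
      have hmain : (-c) ^ d * (Polynomial.C α + Polynomial.C β * Polynomial.X) + q * r ∈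
          Polynomial.degreeLT k (3 * d + 2) := by
        refine add_mem ?_ (mul_mem_degreeLT h.natDegree_q_le hr (by omega))
        rw [mem_degreeLT_succ]
        refine (Polynomial.natDegree_mul_le).trans (add_le_add ?_ hlin)
        rw [Polynomial.natDegree_pow, Polynomial.natDegree_neg, h.natDegree_c, mul_comm]
      rw [Nat.add_sub_cancel] at hd
      fin_cases i
      · refine ⟨_, Polynomial.degreeLT_mono (by omega) hmain, ?_⟩
        simp [hd, apexVec, pderiv_X]
        ring
      · refine ⟨_, mul_mem_degreeLT (m := 1) (N := 3 * (d + 1 + 1) - 3)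
          Polynomial.natDegree_X_le hmain (by omega), ?_⟩
        simp [hd, apexVec, pderiv_X]
        ring
      · refine ⟨-c * r, mul_mem_degreeLT (m := 3)
          (by rw [Polynomial.natDegree_neg, h.natDegree_c]) hr (by omega), ?_⟩
        simp [hd, pderiv_X, ← hα, ← hβ]
        simp [apexVec]
        ring

/-- For a cusp, (-c)^e divides the left side, whose degree is below 3e, so the cofactor -g c + α + β
X is 0, and deg c = 3 separates its terms. For a node, evaluation at 0 gives g = 0 and then α = 0,
and the degree bound gives β = 0. -/
theorem eq_zero_of_apex_relation {e : ℕ} {g α β : k} {s : k[X]}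
    (hs : s ∈ Polynomial.degreeLT k (3 * e))
    (hrel : Polynomial.C g * (-c) ^ (e + 1) +
      (-c) ^ e * q * (Polynomial.C α + Polynomial.C β * Polynomial.X) = q ^ 2 * s) :
    g = 0 ∧ α = 0 ∧ β = 0 := by
  have hc : (-c) ^ e ≠ 0 := pow_ne_zero _ (neg_ne_zero.2 h.c_ne_zero)
  have hcd : ((-c) ^ e).natDegree = 3 * e := by
    rw [Polynomial.natDegree_pow, Polynomial.natDegree_neg, h.natDegree_c, mul_comm]
  have hzero : ∀ f : k[X], (-c) ^ e * f ∈ Polynomial.degreeLT k (3 * e) → f = 0 := by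
    intro f hf
    have := eq_zero_of_mul_mem_degreeLT (n := 0) hcd hc (by omega) hf
    rw [mem_degreeLT_iff_coeff] at this
    exact Polynomial.ext fun i => by simpa using this i (Nat.zero_le _)
  rcases h.cases with rfl | ⟨rfl, h0⟩
  · have h1 := hzero (-Polynomial.C g * c + (Polynomial.C α + Polynomial.C β * Polynomial.X)) (by
      convert hs using 1
      linear_combination hrel)
    have hg : g = 0 := by
      have h3 := congrArg (fun f => Polynomial.coeff f 3) h1
      have h4 : c.coeff 3 ≠ 0 := by
        rw [← h.natDegree_c]
        exact Polynomial.leadingCoeff_ne_zero.2 h.c_ne_zero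
      simpa [Polynomial.coeff_C, Polynomial.coeff_X, h4] using h3
    subst hg
    have e0 := congrArg (fun f => Polynomial.coeff f 0) h1
    have e1 := congrArg (fun f => Polynomial.coeff f 1) h1
    exact ⟨rfl, by simpa using e0, by simpa using e1⟩
  · rw [Polynomial.coeff_zero_eq_eval_zero] at h0
    have hg : g = 0 := by
      have := congrArg (Polynomial.eval 0) hrel
      simpa [h0] using this
    subst hg
    have h1 : (-c) ^ e * (Polynomial.C α + Polynomial.C β * Polynomial.X) = Polynomial.X * s := by
      refine mul_left_cancel₀ Polynomial.X_ne_zero ?_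
      simp at hrel
      linear_combination hrel
    have hα : α = 0 := by
      have := congrArg (Polynomial.eval 0) h1
      simpa [h0] using this
    subst hα
    have h2 : (-c) ^ e * Polynomial.C β = s := by
      refine mul_left_cancel₀ Polynomial.X_ne_zero ?_
      simp at h1
      linear_combination h1
    have := hzero (Polynomial.C β) (h2 ▸ hs)
    exact ⟨rfl, rfl, by simpa using this⟩

/-- Singularity at the singular point of the curve, in terms of the parametrization. -/
theorem doubleAt_apexVec_iff {d : ℕ} {G : MvPolynomial (Fin 3) k} (hG : G.IsHomogeneous d) :
    DoubleAt (apexVec k) G ↔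
      ∃ r ∈ Polynomial.degreeLT k (3 * d - 3), param q c G = q ^ 2 * r := by
  obtain ⟨r, hr, he⟩ := h.apex_expansion hG
  constructor
  · rintro ⟨h0, h1⟩
    refine ⟨r, hr, ?_⟩
    rw [he, h0, h1 0, h1 1]
    simp
  · rintro ⟨s, hs, he'⟩
    have hzero : eval (apexVec k) G = 0 ∧ eval (apexVec k) (pderiv 0 G) = 0 ∧
        eval (apexVec k) (pderiv 1 G) = 0 := by
      rcases d with _ | d
      · obtain ⟨a, rfl⟩ := exists_eq_C hG
        have : s = 0 := by
          rw [mem_degreeLT_iff_coeff] at hs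
          exact Polynomial.ext fun i => by simpa using hs i (Nat.zero_le _)
        have : a = 0 := by simpa [this] using he'
        simp [this]
      · refine h.eq_zero_of_apex_relation (e := d) (s := s - r) (sub_mem hs hr) ?_
        rw [Nat.add_sub_cancel] at he
        linear_combination he' - he
    obtain ⟨h0, h1, h2⟩ := hzero
    refine ⟨h0, fun i => ?_⟩
    -- At (0, 0, 1) Euler's relation reduces to ∂₂G = 0.
    have h3 := euler_eval hG h0
    fin_cases i
    · exact h1
    · exact h2
    · simpa [apexVec, h1, h2] using h3

end IsParam

/-- A plane cubic with singular point `(0 : 0 : 1)`, parametrized by `u ↦ (q : u q : -c)`. -/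
structure IsParamCubic (F : MvPolynomial (Fin 3) k) (q c : k[X]) : Prop extends IsParam q c where
  hom : F.IsHomogeneous 3
  irr : Irreducible F
  param_self : param q c F = 0
  exists_eq_smul : ∀ v, eval v F = 0 → v 0 ≠ 0 →
    q.eval (v 1 / v 0) ≠ 0 ∧ ∃ s : k, v = s • curveVec q c (v 1 / v 0)
  apex_of_zero : ∀ v, eval v F = 0 → v 0 = 0 → v 1 = 0
  pderiv_ne_zero : ∀ u, q.eval u ≠ 0 → eval (curveVec q c u) (pderiv 2 F) ≠ 0

omit [Field k] in
theorem vec_eq (v : Fin 3 → k) : v = ![v 0, v 1, v 2] := by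
  ext i
  fin_cases i <;> rfl

theorem isParamCubic_node {c₀ c₁ c₂ c₃ : k} (h₀ : c₀ ≠ 0) (h₃ : c₃ ≠ 0)
    (hF : (conicCubic 0 1 0 c₀ c₁ c₂ c₃).IsHomogeneous 3)
    (hirr : Irreducible (conicCubic 0 1 0 c₀ c₁ c₂ c₃)) :
    IsParamCubic (conicCubic 0 1 0 c₀ c₁ c₂ c₃) Polynomial.X
      (Polynomial.C c₀ * Polynomial.X ^ 3 + Polynomial.C c₁ * Polynomial.X ^ 2 +
        Polynomial.C c₂ * Polynomial.X + Polynomial.C c₃) where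
  natDegree_c := Polynomial.natDegree_cubic h₀
  cases := Or.inr ⟨rfl, by simpa using h₃⟩
  hom := hF
  irr := hirr
  param_self := by
    simp [conicCubic]
    ring
  exists_eq_smul := by
    intro v hv h0
    rw [eval_conicCubic] at hv
    have h1 : v 1 ≠ 0 := by
      intro h1
      simp [h1, h₃, h0] at hv
    -- For a node the first coordinate of `curveVec` at u = v₁ / v₀ is u itself, so the scale is v₀
    -- / u.
    refine ⟨by simpa using ⟨h1, h0⟩, v 0 ^ 2 / v 1, ?_⟩
    conv_lhs => rw [vec_eq v]
    ext i
    fin_cases i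
    · simp [curveVec]
      field_simp
    · simp [curveVec]
      field_simp
    · simp [curveVec]
      field_simp
      linear_combination hv
  apex_of_zero := by
    intro v hv h0
    rw [eval_conicCubic] at hv
    simpa [h0, h₀] using hv
  pderiv_ne_zero := by
    intro u hu
    simp at hu
    simp [conicCubic, curveVec, pderiv_X, hu]

theorem isParamCubic_cusp {c₀ c₁ c₂ c₃ : k} (h₀ : c₀ ≠ 0)
    (hF : (conicCubic 1 0 0 c₀ c₁ c₂ c₃).IsHomogeneous 3)
    (hirr : Irreducible (conicCubic 1 0 0 c₀ c₁ c₂ c₃)) :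
    IsParamCubic (conicCubic 1 0 0 c₀ c₁ c₂ c₃) 1
      (Polynomial.C c₀ * Polynomial.X ^ 3 + Polynomial.C c₁ * Polynomial.X ^ 2 +
        Polynomial.C c₂ * Polynomial.X + Polynomial.C c₃) where
  natDegree_c := Polynomial.natDegree_cubic h₀
  cases := Or.inl rfl
  hom := hF
  irr := hirr
  param_self := by
    simp [conicCubic]
    ring
  exists_eq_smul := by
    intro v hv h0
    rw [eval_conicCubic] at hv
    refine ⟨by simp, v 0, ?_⟩
    conv_lhs => rw [vec_eq v]
    ext i
    fin_cases i
    · simp [curveVec]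
    · simp [curveVec]
      field_simp
    · simp [curveVec]
      field_simp
      linear_combination hv
  apex_of_zero := by
    intro v hv h0
    rw [eval_conicCubic] at hv
    simpa [h0, h₀] using hv
  pderiv_ne_zero := by
    intro u _
    simp [conicCubic, curveVec, pderiv_X]

namespace IsParamCubic

variable {F : MvPolynomial (Fin 3) k} (h : IsParamCubic F q c)
include h

/-- By the Nullstellensatz the prime ideal (F) contains every polynomial vanishing on C. The
parametrization controls only the points with x ≠ 0, so the argument is applied to x G; the prime F
cannot divide x for degree reasons. -/
theorem dvd_of_param_eq_zero [IsAlgClosed k] {d : ℕ} {G : MvPolynomial (Fin 3) k}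
    (hG : G.IsHomogeneous d) (h0 : param q c G = 0) : F ∣ G := by
  have hprime : Prime F := UniqueFactorizationMonoid.irreducible_iff_prime.1 h.irr
  have : (Ideal.span {F}).IsPrime := (Ideal.span_singleton_prime hprime.ne_zero).2 hprime
  have hmem : X 0 * G ∈ vanishingIdeal k (zeroLocus k (Ideal.span {F})) := by
    rw [mem_vanishingIdeal_iff]
    intro v hv
    have hFv : eval v F = 0 := hv F (Ideal.mem_span_singleton_self F)
    change eval v (X 0 * G) = 0
    rw [map_mul, eval_X]
    by_cases hv0 : v 0 = 0
    · rw [hv0, zero_mul]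
    · obtain ⟨-, s, hs⟩ := h.exists_eq_smul v hFv hv0
      rw [hs, eval_smul_of_isHomogeneous hG, ← eval_param, h0]
      simp
  rw [IsPrime.vanishingIdeal_zeroLocus, Ideal.mem_span_singleton] at hmem
  refine (hprime.dvd_or_dvd hmem).resolve_left ?_
  rintro ⟨H, hH⟩
  have hH0 : H ≠ 0 := by
    rintro rfl
    simp at hH
  have := congrArg totalDegree hH
  rw [totalDegree_X, totalDegree_mul_of_isDomain hprime.ne_zero hH0,
    h.hom.totalDegree hprime.ne_zero] at this
  omega

end IsParamCubic

/-- A cofactor may be replaced by its component of degree d - e, as the other components do not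
contribute to degree d. -/
theorem exists_isHomogeneous_of_dvd {e d : ℕ} {F G : MvPolynomial (Fin 3) k}
    (hF : F.IsHomogeneous e) (hG : G.IsHomogeneous d) (h : F ∣ G) :
    G = 0 ∨ e ≤ d ∧ ∃ H : MvPolynomial (Fin 3) k, H.IsHomogeneous (d - e) ∧ G = F * H := by
  obtain ⟨H, rfl⟩ := h
  by_cases hed : e ≤ d
  · refine Or.inr ⟨hed, homogeneousComponent (d - e) H, homogeneousComponent_isHomogeneous _ _, ?_⟩
    have h1 : homogeneousComponent d (F * H) = F * H := homogeneousComponent_of_mem hG |>.trans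
      (if_pos rfl)
    have h2 : homogeneousComponent d (F * H) = F * homogeneousComponent (d - e) H := by
      conv_lhs => rw [← sum_homogeneousComponent H, Finset.mul_sum, map_sum]
      have : ∀ i, homogeneousComponent d (F * homogeneousComponent i H) =
          if i = d - e then F * homogeneousComponent (d - e) H else 0 := by
        intro i
        rw [homogeneousComponent_of_mem (hF.mul (homogeneousComponent_isHomogeneous i H))]
        by_cases hi : i = d - e
        · subst hi
          rw [if_pos (by omega), if_pos rfl]
        · rw [if_neg (by omega), if_neg hi]
      simp only [this, Finset.sum_ite_eq', Finset.mem_range]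
      split_ifs with hlt
      · rfl
      · rw [homogeneousComponent_eq_zero _ _ (by omega), mul_zero]
    rw [← h2, h1]
  · left
    by_contra hne
    have hne' := mul_ne_zero_iff.1 hne
    have := hG.totalDegree hne
    rw [totalDegree_mul_of_isDomain hne'.1 hne'.2, hF.totalDegree hne'.1] at this
    omega

end Parametrization

end FatPoints

namespace FatPoints

open MvPolynomial
open scoped Polynomial

/-! ### Restriction of double forms to the cubic and the residual forms -/

section DoublePointsOnCubic

variable {k : Type*} [Field k]

/-- The monic polynomial with the simple roots `u ∈ U`. -/
noncomputable def rootPoly (U : Finset k) : k[X] := ∏ u ∈ U, (Polynomial.X - Polynomial.C u)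

theorem rootPoly_ne_zero (U : Finset k) : rootPoly U ≠ 0 :=
  (Polynomial.monic_prod_of_monic _ _ fun u _ => Polynomial.monic_X_sub_C u).ne_zero

theorem natDegree_rootPoly (U : Finset k) : (rootPoly U).natDegree = U.card := by
  rw [rootPoly, Polynomial.natDegree_prod_of_monic _ _ fun u _ => Polynomial.monic_X_sub_C u]
  simp

theorem isCoprime_X_sub_C_of_ne {u v : k} (huv : u ≠ v) :
    IsCoprime (Polynomial.X - Polynomial.C u) (Polynomial.X - Polynomial.C v) :=
  Polynomial.isCoprime_X_sub_C_of_isUnit_sub (sub_ne_zero.2 huv).isUnit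

theorem rootPoly_dvd_iff {U : Finset k} {f : k[X]} :
    rootPoly U ∣ f ↔ ∀ u ∈ U, f.eval u = 0 := by
  constructor
  · intro h u hu
    exact Polynomial.dvd_iff_isRoot.1
      ((Finset.dvd_prod_of_mem (fun u => Polynomial.X - Polynomial.C u) hu).trans h)
  · intro h
    rw [rootPoly]
    refine Finset.prod_dvd_of_coprime ?_ fun u hu => Polynomial.dvd_iff_isRoot.2 (h u hu)
    intro u _ v _ huv
    exact isCoprime_X_sub_C_of_ne huv

theorem X_sub_C_sq_dvd_iff {u : k} {f : k[X]} : (Polynomial.X - Polynomial.C u) ^ 2 ∣ f ↔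
    f.eval u = 0 ∧ f.derivative.eval u = 0 := by
  constructor
  · rintro ⟨g, rfl⟩
    simp [Polynomial.derivative_mul, Polynomial.derivative_pow]
  · rintro ⟨h0, h1⟩
    obtain ⟨g, rfl⟩ := Polynomial.dvd_iff_isRoot.2 h0
    rw [pow_two]
    refine mul_dvd_mul_left _ (Polynomial.dvd_iff_isRoot.2 ?_)
    simpa [Polynomial.derivative_mul] using h1

theorem rootPoly_sq_dvd_iff {U : Finset k} {f : k[X]} :
    rootPoly U ^ 2 ∣ f ↔ ∀ u ∈ U, f.eval u = 0 ∧ f.derivative.eval u = 0 := by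
  simp only [← X_sub_C_sq_dvd_iff]
  rw [rootPoly, ← Finset.prod_pow]
  constructor
  · intro h u hu
    exact (Finset.dvd_prod_of_mem (fun u => (Polynomial.X - Polynomial.C u) ^ 2) hu).trans h
  · intro h
    refine Finset.prod_dvd_of_coprime ?_ h
    intro u _ v _ huv
    change IsCoprime ((Polynomial.X - Polynomial.C u) ^ 2) ((Polynomial.X - Polynomial.C v) ^ 2)
    exact (isCoprime_X_sub_C_of_ne huv).pow

theorem isCoprime_rootPoly {U : Finset k} {q : k[X]} (hU : ∀ u ∈ U, q.eval u ≠ 0) :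
    IsCoprime (rootPoly U) q := by
  refine IsCoprime.prod_left fun u hu => ?_
  rw [(Polynomial.irreducible_X_sub_C u).coprime_iff_not_dvd, Polynomial.dvd_iff_isRoot]
  exact hU u hu

theorem rootPoly_coeff_zero_ne_zero {U : Finset k} {q : k[X]} (hU : ∀ u ∈ U, q.eval u ≠ 0)
    (hq : q = Polynomial.X) : (rootPoly U).coeff 0 ≠ 0 := by
  rw [Polynomial.coeff_zero_eq_eval_zero, rootPoly, Polynomial.eval_prod, Finset.prod_ne_zero_iff]
  intro u hu
  have := hU u hu
  simpa [hq] using this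

instance (d : ℕ) : FiniteDimensional k (homogeneousSubmodule (Fin 3) k d) :=
  Module.Finite.iff_fg.2 (homogeneousSubmodule_fg _ _ d)

variable (q c : k[X]) (U : Finset k)

/-- The forms of degree `d` vanishing at the points with parameters in `U`. -/
noncomputable def simpleForms (d : ℕ) : Submodule k (MvPolynomial (Fin 3) k) :=
  homogeneousSubmodule (Fin 3) k d ⊓
    (LinearMap.range (LinearMap.mulLeft k (rootPoly U))).comap (param q c).toLinearMap

/-- The forms of degree `d` singular at `(0 : 0 : 1)` and at the points with parameters in `U`. -/
noncomputable def doubleForms (d : ℕ) : Submodule k (MvPolynomial (Fin 3) k) where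
  carrier := {G | G.IsHomogeneous d ∧ DoubleAt (apexVec k) G ∧
    ∀ u ∈ U, DoubleAt (curveVec q c u) G}
  zero_mem' := ⟨isHomogeneous_zero _ _ _, by simp [DoubleAt], by simp [DoubleAt]⟩
  add_mem' := by
    rintro a b ⟨ha, ha', ha''⟩ ⟨hb, hb', hb''⟩
    have key : ∀ v, DoubleAt v a → DoubleAt v b → DoubleAt v (a + b) := fun v h1 h2 =>
      ⟨by rw [map_add, h1.1, h2.1, add_zero], fun i => by
        rw [map_add, map_add, h1.2, h2.2, add_zero]⟩
    exact ⟨ha.add hb, key _ ha' hb', fun u hu => key _ (ha'' u hu) (hb'' u hu)⟩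
  smul_mem' := by
    rintro s a ⟨ha, ha', ha''⟩
    have key : ∀ v, DoubleAt v a → DoubleAt v (s • a) := fun v h1 =>
      ⟨by rw [smul_eval, h1.1, mul_zero], fun i => by
        rw [Derivation.map_smul, smul_eval, h1.2, mul_zero]⟩
    exact ⟨(homogeneousSubmodule (Fin 3) k d).smul_mem s ha, key _ ha',
      fun u hu => key _ (ha'' u hu)⟩

variable {q c U}

theorem mem_simpleForms {d : ℕ} {G : MvPolynomial (Fin 3) k} :
    G ∈ simpleForms q c U d ↔ G.IsHomogeneous d ∧ ∀ u ∈ U, (param q c G).eval u = 0 := by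
  rw [← rootPoly_dvd_iff]
  simp only [simpleForms, Submodule.mem_inf, mem_homogeneousSubmodule, Submodule.mem_comap,
    LinearMap.mem_range, LinearMap.mulLeft_apply, AlgHom.toLinearMap_apply, dvd_def, eq_comm]

theorem mem_doubleForms {d : ℕ} {G : MvPolynomial (Fin 3) k} :
    G ∈ doubleForms q c U d ↔ G.IsHomogeneous d ∧ DoubleAt (apexVec k) G ∧
    ∀ u ∈ U, DoubleAt (curveVec q c u) G := Iff.rfl

instance (d : ℕ) : FiniteDimensional k (simpleForms q c U d) :=
  Submodule.finiteDimensional_inf_left _ _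

instance (d : ℕ) : FiniteDimensional k (doubleForms q c U d) :=
  Submodule.finiteDimensional_of_le (S₂ := homogeneousSubmodule (Fin 3) k d) fun _ h => h.1

theorem IsParam.map_param_homogeneousSubmodule (h : IsParam q c) (d : ℕ) :
    (homogeneousSubmodule (Fin 3) k d).map (param q c).toLinearMap = curveForms q c d := by
  ext f
  constructor
  · rintro ⟨G, hG, rfl⟩
    exact h.param_mem_curveForms hG
  · intro hf
    obtain ⟨G, hG, rfl⟩ := h.exists_param_eq hf
    exact ⟨G, hG, rfl⟩

theorem IsParam.map_param_simpleForms (h : IsParam q c) (d : ℕ) :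
    (simpleForms q c U d).map (param q c).toLinearMap = curveFormsThrough q c (rootPoly U) d := by
  ext f
  rw [mem_curveFormsThrough, rootPoly_dvd_iff]
  constructor
  · rintro ⟨G, hG, rfl⟩
    rw [SetLike.mem_coe, mem_simpleForms] at hG
    exact ⟨h.param_mem_curveForms hG.1, hG.2⟩
  · rintro ⟨hf, h0⟩
    obtain ⟨G, hG, rfl⟩ := h.exists_param_eq hf
    exact ⟨G, mem_simpleForms.2 ⟨hG, h0⟩, rfl⟩

theorem simpleForms_inf_ker (d : ℕ) :
    simpleForms q c U d ⊓ LinearMap.ker (param q c).toLinearMap =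
      homogeneousSubmodule (Fin 3) k d ⊓ LinearMap.ker (param q c).toLinearMap := by
  ext G
  simp only [Submodule.mem_inf, mem_simpleForms, LinearMap.mem_ker, AlgHom.toLinearMap_apply,
    mem_homogeneousSubmodule]
  constructor
  · rintro ⟨⟨h1, -⟩, h2⟩
    exact ⟨h1, h2⟩
  · rintro ⟨h1, h2⟩
    exact ⟨⟨h1, by simp [h2]⟩, h2⟩

/-- Restriction to C has the same kernel on all forms and on those through the points, so the
codimensions before and after restriction agree. -/
theorem IsParam.finrank_homogeneous_add (h : IsParam q c) (d : ℕ) :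
    Module.finrank k (homogeneousSubmodule (Fin 3) k d) +
        Module.finrank k (curveFormsThrough q c (rootPoly U) d) =
      Module.finrank k (simpleForms q c U d) + Module.finrank k (curveForms q c d) := by
  rw [← finrank_map_add_finrank_inf_ker (param q c).toLinearMap (homogeneousSubmodule (Fin 3) k d),
    ← finrank_map_add_finrank_inf_ker (param q c).toLinearMap (simpleForms q c U d),
    simpleForms_inf_ker, h.map_param_homogeneousSubmodule, h.map_param_simpleForms]
  ring

/-- Interpolation at the points with parameters in `U`. -/
theorem IsParam.exists_interpolation (h : IsParam q c) (hU : ∀ u ∈ U, q.eval u ≠ 0) {e : ℕ}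
    (he : U.card < 3 * e) (w : k → k) : ∃ A : MvPolynomial (Fin 3) k, A.IsHomogeneous e ∧
      ∀ u ∈ U, eval (curveVec q c u) A = w u := by
  let ev : k[X] →ₗ[k] (U → k) := LinearMap.pi fun u => Polynomial.leval (u : k)
  have h1 := finrank_map_add_finrank_inf_ker ev (curveForms q c e)
  have h2 : curveForms q c e ⊓ LinearMap.ker ev = curveFormsThrough q c (rootPoly U) e := by
    ext f
    rw [mem_curveFormsThrough, rootPoly_dvd_iff, Submodule.mem_inf, LinearMap.mem_ker]
    simp [ev, funext_iff, Polynomial.leval]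
  rw [h2, h.finrank_curveForms (by omega), h.finrank_curveFormsThrough_of_lt (rootPoly_ne_zero U)
    (natDegree_rootPoly U) he (rootPoly_coeff_zero_ne_zero hU)] at h1
  -- Evaluation has rank 3e - (3e - n) = n, hence is onto; the lift then supplies the form.
  have h3 : (curveForms q c e).map ev = ⊤ := by
    apply Submodule.eq_top_of_finrank_eq
    rw [Module.finrank_fintype_fun_eq_card, Fintype.card_coe]
    omega
  obtain ⟨f, hf, hfw⟩ := (h3 ▸ Submodule.mem_top : (fun u : U => w u) ∈ (curveForms q c e).map ev)
  obtain ⟨A, hA, rfl⟩ := h.exists_param_eq hf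
  refine ⟨A, hA, fun u hu => ?_⟩
  rw [← eval_param]
  exact congrFun hfw ⟨u, hu⟩

namespace IsParamCubic

variable {F : MvPolynomial (Fin 3) k} (h : IsParamCubic F q c)
include h

theorem eval_self (u : k) : eval (curveVec q c u) F = 0 := by
  rw [← eval_param, h.param_self, Polynomial.eval_zero]

/-- F A restricts to 0, so it is automatically singular at P. At a smooth point only ∂₂(F A) = A ∂₂F
remains to be tested there, and ∂₂F ≠ 0: lines through P meet C transversally at its other points.
-/
theorem mul_mem_doubleForms_iff (hU : ∀ u ∈ U, q.eval u ≠ 0) {d : ℕ}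
    {A : MvPolynomial (Fin 3) k} (hA : A.IsHomogeneous d) :
    F * A ∈ doubleForms q c U (3 + d) ↔ A ∈ simpleForms q c U d := by
  have hFA := h.hom.mul hA
  have h0 : param q c (F * A) = 0 := by rw [map_mul, h.param_self, zero_mul]
  rw [mem_doubleForms, mem_simpleForms, h.doubleAt_apexVec_iff hFA]
  have h1 : ∀ u ∈ U, (DoubleAt (curveVec q c u) (F * A) ↔ (param q c A).eval u = 0) := by
    intro u hu
    rw [doubleAt_curveVec_iff hFA (hU u hu), h0, pderiv_mul, map_add, map_mul, map_mul,
      h.eval_self, zero_mul, add_zero, mul_eq_zero, eval_param]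
    simp [h.pderiv_ne_zero u (hU u hu)]
  constructor
  · rintro ⟨-, -, h2⟩
    exact ⟨hA, fun u hu => (h1 u hu).1 (h2 u hu)⟩
  · rintro ⟨-, h2⟩
    exact ⟨hFA, ⟨0, zero_mem _, by simp [h0]⟩, fun u hu => (h1 u hu).2 (h2 u hu)⟩

theorem inf_ker_param_eq_bot [IsAlgClosed k] {d : ℕ} (hd : d < 3) :
    homogeneousSubmodule (Fin 3) k d ⊓ LinearMap.ker (param q c).toLinearMap = ⊥ := by
  rw [eq_bot_iff]
  rintro G ⟨hG, h0⟩
  rcases exists_isHomogeneous_of_dvd h.hom hG (h.dvd_of_param_eq_zero hG h0) with h1 | ⟨h1, -⟩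
  · exact h1
  · omega

theorem inf_ker_param_eq_map [IsAlgClosed k] (d : ℕ) :
    homogeneousSubmodule (Fin 3) k (3 + d) ⊓ LinearMap.ker (param q c).toLinearMap =
      (homogeneousSubmodule (Fin 3) k d).map (LinearMap.mulLeft k F) := by
  ext G
  constructor
  · rintro ⟨hG, h0⟩
    rcases exists_isHomogeneous_of_dvd h.hom hG (h.dvd_of_param_eq_zero hG h0) with
      rfl | ⟨-, H, hH, rfl⟩
    · exact zero_mem _
    · rw [Nat.add_sub_cancel_left] at hH
      exact ⟨H, hH, rfl⟩
  · rintro ⟨H, hH, rfl⟩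
    exact ⟨h.hom.mul hH, by simp [h.param_self]⟩

theorem doubleForms_inf_ker_eq_map [IsAlgClosed k] (hU : ∀ u ∈ U, q.eval u ≠ 0) (d : ℕ) :
    doubleForms q c U (3 + d) ⊓ LinearMap.ker (param q c).toLinearMap =
      (simpleForms q c U d).map (LinearMap.mulLeft k F) := by
  ext G
  constructor
  · rintro ⟨hG, h0⟩
    have : G ∈ homogeneousSubmodule (Fin 3) k (3 + d) ⊓
      LinearMap.ker (param q c).toLinearMap := ⟨hG.1, h0⟩
    rw [h.inf_ker_param_eq_map] at this
    obtain ⟨H, hH, rfl⟩ := this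
    exact ⟨H, (h.mul_mem_doubleForms_iff hU hH).1 hG, rfl⟩
  · rintro ⟨H, hH, rfl⟩
    exact ⟨(h.mul_mem_doubleForms_iff hU (mem_simpleForms.1 hH).1).2 hH, by simp [h.param_self]⟩

theorem finrank_map_mulLeft (S : Submodule k (MvPolynomial (Fin 3) k)) :
    Module.finrank k (S.map (LinearMap.mulLeft k F)) = Module.finrank k S :=
  finrank_map_of_injOn _ _ fun _ _ hx => (mul_eq_zero.1 hx).resolve_left h.irr.ne_zero

theorem map_param_doubleForms_le (hU : ∀ u ∈ U, q.eval u ≠ 0) (d : ℕ) :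
    (doubleForms q c U d).map (param q c).toLinearMap ≤
      (Polynomial.degreeLT k (3 * d - 3 - 2 * U.card)).map
        (LinearMap.mulLeft k (q ^ 2 * rootPoly U ^ 2)) := by
  rintro _ ⟨G, ⟨hG, hP, hGU⟩, rfl⟩
  obtain ⟨r, hr, he⟩ := (h.doubleAt_apexVec_iff hG).1 hP
  have hdvd : rootPoly U ^ 2 ∣ q ^ 2 * r := by
    rw [← he, rootPoly_sq_dvd_iff]
    intro u hu
    have := (doubleAt_curveVec_iff hG (hU u hu)).1 (hGU u hu)
    exact ⟨this.1, this.2.1⟩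
  -- The roots of L avoid the zeros of q, so L² divides the cofactor r.
  obtain ⟨s, rfl⟩ := (isCoprime_rootPoly hU).pow.dvd_of_dvd_mul_left hdvd
  refine ⟨s, eq_zero_of_mul_mem_degreeLT (m := 2 * U.card) ?_ (pow_ne_zero 2 (rootPoly_ne_zero U))
    (by omega) hr, ?_⟩
  · rw [Polynomial.natDegree_pow, natDegree_rootPoly]
  · rw [LinearMap.mulLeft_apply, mul_assoc, ← he, AlgHom.toLinearMap_apply]

/-- A lift G of q² L² s is singular at P and tangent to the requirement along C; only ∂₂G at the
smooth points may be wrong. Adding F A leaves the restriction unchanged and shifts ∂₂G by A ∂₂F. -/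
theorem le_map_param_doubleForms (hU : ∀ u ∈ U, q.eval u ≠ 0) {d : ℕ} (hd : U.card < 3 * d)
    (hd' : 2 * U.card ≤ 3 * (3 + d) - 3) :
    (Polynomial.degreeLT k (3 * (3 + d) - 3 - 2 * U.card)).map
        (LinearMap.mulLeft k (q ^ 2 * rootPoly U ^ 2)) ≤
      (doubleForms q c U (3 + d)).map (param q c).toLinearMap := by
  rintro _ ⟨s, hs, rfl⟩
  have hdeg : rootPoly U ^ 2 * s ∈ Polynomial.degreeLT k (3 * (3 + d) - 3) := by
    refine mul_mem_degreeLT (m := 2 * U.card) ?_ hs (by omega)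
    rw [Polynomial.natDegree_pow, natDegree_rootPoly]
  have hmem : q ^ 2 * rootPoly U ^ 2 * s ∈ curveForms q c (3 + d) :=
    mem_curveForms.2 ⟨0, q * (rootPoly U ^ 2 * s),
      mul_mem_degreeLT h.natDegree_q_le hdeg (by omega), by simp; ring⟩
  obtain ⟨G, hG, hGe⟩ := h.exists_param_eq hmem
  obtain ⟨A, hA, hAw⟩ := h.exists_interpolation hU hd fun u =>
    -eval (curveVec q c u) (pderiv 2 G) / eval (curveVec q c u) (pderiv 2 F)
  have hhom : (G + F * A).IsHomogeneous (3 + d) := hG.add (h.hom.mul hA)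
  have hpar : param q c (G + F * A) = q ^ 2 * rootPoly U ^ 2 * s := by
    rw [map_add, map_mul, h.param_self, zero_mul, add_zero, hGe]
  refine ⟨G + F * A, ⟨hhom, (h.doubleAt_apexVec_iff hhom).2 ⟨_, hdeg, by rw [hpar]; ring⟩,
    fun u hu => ?_⟩, hpar⟩
  have hroot := rootPoly_sq_dvd_iff.1
    (⟨q ^ 2 * s, by ring⟩ : rootPoly U ^ 2 ∣ q ^ 2 * rootPoly U ^ 2 * s) u hu
  rw [doubleAt_curveVec_iff hhom (hU u hu), hpar]
  refine ⟨hroot.1, hroot.2, ?_⟩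
  rw [map_add, pderiv_mul, map_add, map_add, map_mul, map_mul, h.eval_self, hAw u hu, zero_mul,
    add_zero, mul_div_cancel₀ _ (h.pderiv_ne_zero u (hU u hu)), add_neg_cancel]

theorem finrank_map_param_doubleForms (hU : ∀ u ∈ U, q.eval u ≠ 0) (hcard : 6 ≤ U.card) (d : ℕ) :
    Module.finrank k ((doubleForms q c U d).map (param q c).toLinearMap) =
      3 * d - 3 - 2 * U.card := by
  have h1 : Module.finrank k ((Polynomial.degreeLT k (3 * d - 3 - 2 * U.card)).map
      (LinearMap.mulLeft k (q ^ 2 * rootPoly U ^ 2))) = 3 * d - 3 - 2 * U.card := by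
    rw [finrank_map_of_injOn, finrank_degreeLT]
    intro x _ hx
    exact (mul_eq_zero.1 hx).resolve_left
      (mul_ne_zero (pow_ne_zero 2 h.q_ne_zero) (pow_ne_zero 2 (rootPoly_ne_zero U)))
  have hle := h.map_param_doubleForms_le hU d
  rcases Nat.eq_zero_or_pos (3 * d - 3 - 2 * U.card) with h0 | hpos
  · have := Submodule.finrank_mono hle
    omega
  · obtain ⟨e, rfl⟩ : ∃ e, d = 3 + e := ⟨d - 3, by omega⟩
    rw [← h1]
    exact congrArg (fun S : Submodule k k[X] => Module.finrank k S)
      (le_antisymm hle (h.le_map_param_doubleForms hU (by omega) (by omega)))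

/-- The codimension of the space of forms of degree `3 + d` that are singular at the given
points of the cubic. -/
theorem finrank_doubleForms_add_three [IsAlgClosed k] (hU : ∀ u ∈ U, q.eval u ≠ 0)
    (hcard : 6 ≤ U.card) (d : ℕ) :
    Module.finrank k (homogeneousSubmodule (Fin 3) k (3 + d)) + (3 * (3 + d) - 3 - 2 * U.card) +
        Module.finrank k (curveFormsThrough q c (rootPoly U) d) =
      Module.finrank k (doubleForms q c U (3 + d)) + Module.finrank k (curveForms q c (3 + d)) +
        Module.finrank k (curveForms q c d) := by
  have h1 := finrank_map_add_finrank_inf_ker (param q c).toLinearMap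
    (homogeneousSubmodule (Fin 3) k (3 + d))
  have h2 := finrank_map_add_finrank_inf_ker (param q c).toLinearMap (doubleForms q c U (3 + d))
  have h3 := h.finrank_homogeneous_add (U := U) d
  rw [h.map_param_homogeneousSubmodule, h.inf_ker_param_eq_map, h.finrank_map_mulLeft] at h1
  rw [h.finrank_map_param_doubleForms hU hcard, h.doubleForms_inf_ker_eq_map hU,
    h.finrank_map_mulLeft] at h2
  omega

/-- Below degree 3 restriction to C is injective, and the restricted double forms vanish because 3d
- 3 - 2n truncates to 0. -/
theorem finrank_doubleForms_of_lt [IsAlgClosed k] (hU : ∀ u ∈ U, q.eval u ≠ 0)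
    (hcard : 6 ≤ U.card) {d : ℕ} (hd : d < 3) :
    Module.finrank k (homogeneousSubmodule (Fin 3) k d) =
      Module.finrank k (doubleForms q c U d) + Module.finrank k (curveForms q c d) := by
  have h1 := finrank_map_add_finrank_inf_ker (param q c).toLinearMap
    (homogeneousSubmodule (Fin 3) k d)
  have h2 := finrank_map_add_finrank_inf_ker (param q c).toLinearMap (doubleForms q c U d)
  have h3 : doubleForms q c U d ⊓ LinearMap.ker (param q c).toLinearMap = ⊥ := by
    rw [eq_bot_iff, ← h.inf_ker_param_eq_bot hd]
    exact inf_le_inf_right _ fun G hG => hG.1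
  rw [h.map_param_homogeneousSubmodule, h.inf_ker_param_eq_bot hd, finrank_bot] at h1
  rw [h.finrank_map_param_doubleForms hU hcard, h3, finrank_bot] at h2
  omega

end IsParamCubic

end DoublePointsOnCubic

end FatPoints

namespace FatPoints

open MvPolynomial
open scoped Polynomial

/-! ### From sets of points on the cubic to sets of parameters -/

section Support

variable {k : Type*} [Field k]

open Classical in
/-- The point `(q(u) : u q(u) : -c(u))` of the curve. -/
noncomputable def curvePoint (q c : k[X]) (u : k) : Plane k :=
  if hv : curveVec q c u ≠ 0 then Projectivization.mk k _ hv else apex k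

open Classical in
/-- The singular point together with the points with parameters in `U`. -/
noncomputable def supportSet (q c : k[X]) (U : Finset k) : Finset (Plane k) :=
  insert (apex k) (U.image (curvePoint q c))

variable {q c : k[X]} {U : Finset k}

theorem curveVec_ne_zero {u : k} (hu : q.eval u ≠ 0) : curveVec q c u ≠ 0 := fun h =>
  hu (congrFun h 0)

theorem curvePoint_eq {u : k} (hu : q.eval u ≠ 0) :
    curvePoint q c u = Projectivization.mk k (curveVec q c u) (curveVec_ne_zero hu) :=
  dif_pos (curveVec_ne_zero hu)

theorem curvePoint_injOn (hU : ∀ u ∈ U, q.eval u ≠ 0) : Set.InjOn (curvePoint q c) U := by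
  intro u hu v hv huv
  rw [curvePoint_eq (hU u hu), curvePoint_eq (hU v hv), Projectivization.mk_eq_mk_iff'] at huv
  obtain ⟨s, hs⟩ := huv
  have h0 : s * q.eval v = q.eval u := congrFun hs 0
  have h1 : s * (v * q.eval v) = u * q.eval u := congrFun hs 1
  refine mul_right_cancel₀ (hU u hu) ?_
  linear_combination -h1 + v * h0

theorem curvePoint_ne_apex {u : k} (hu : q.eval u ≠ 0) : curvePoint q c u ≠ apex k := by
  intro h
  rw [curvePoint_eq hu, apex, Projectivization.mk_eq_mk_iff'] at h
  obtain ⟨s, hs⟩ := h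
  have h0 : s * 0 = q.eval u := congrFun hs 0
  exact hu (by rw [← h0, mul_zero])

theorem card_supportSet (hU : ∀ u ∈ U, q.eval u ≠ 0) :
    (supportSet q c U).card = U.card + 1 := by
  classical
  rw [supportSet, Finset.card_insert_of_notMem, Finset.card_image_of_injOn (curvePoint_injOn hU)]
  rw [Finset.mem_image]
  rintro ⟨u, hu, h⟩
  exact curvePoint_ne_apex (hU u hu) h

theorem mem_fatIdeal_supportSet (hU : ∀ u ∈ U, q.eval u ≠ 0) {d : ℕ}
    {G : MvPolynomial (Fin 3) k} (hG : G.IsHomogeneous d) :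
    G ∈ fatIdeal 2 (supportSet q c U) ↔ G ∈ doubleForms q c U d := by
  classical
  rw [mem_fatIdeal, supportSet, Finset.forall_mem_insert, Finset.forall_mem_image, mem_doubleForms,
    apex, mem_pointIdeal_mk_sq_iff hG]
  simp only [hG, true_and]
  refine and_congr_right fun _ => forall₂_congr fun u hu => ?_
  rw [curvePoint_eq (hU u hu), mem_pointIdeal_mk_sq_iff hG]

theorem hilbertFn_supportSet_add (hU : ∀ u ∈ U, q.eval u ≠ 0) (d : ℕ) :
    hilbertFn (fatIdeal 2 (supportSet q c U)) d + Module.finrank k (doubleForms q c U d) =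
      Module.finrank k (homogeneousSubmodule (Fin 3) k d) := by
  rw [hilbertFn, ← Submodule.finrank_quotient_add_finrank
    (((fatIdeal 2 (supportSet q c U)).restrictScalars k).comap
      (homogeneousSubmodule (Fin 3) k d).subtype)]
  congr 1
  rw [← finrank_map_of_injOn (homogeneousSubmodule (Fin 3) k d).subtype _
    fun x _ hx => Subtype.ext hx, Submodule.map_comap_subtype]
  have : homogeneousSubmodule (Fin 3) k d ⊓ (fatIdeal 2 (supportSet q c U)).restrictScalars k =
      doubleForms q c U d := by
    ext G
    constructor
    · rintro ⟨h1, h2⟩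
      exact (mem_fatIdeal_supportSet hU h1).1 h2
    · intro hG
      exact ⟨hG.1, (mem_fatIdeal_supportSet hU hG.1).2 hG⟩
  rw [this]

namespace IsParamCubic

variable {F : MvPolynomial (Fin 3) k} (h : IsParamCubic F q c)
include h

theorem eq_curvePoint {p : Plane k} (hp : VanishesAt F p) (hne : p ≠ apex k) :
    ∃ u, q.eval u ≠ 0 ∧ p = curvePoint q c u := by
  induction p using Projectivization.ind with
  | h v hv =>
  rw [vanishesAt_mk h.hom] at hp
  have h0 : v 0 ≠ 0 := by
    intro h0
    have h1 := h.apex_of_zero v hp h0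
    refine hne ?_
    rw [apex, Projectivization.mk_eq_mk_iff']
    refine ⟨v 2, ?_⟩
    rw [vec_eq v, h0, h1]
    simp [apexVec]
  obtain ⟨hq, s, hs⟩ := h.exists_eq_smul v hp h0
  refine ⟨_, hq, ?_⟩
  rw [curvePoint_eq hq, Projectivization.mk_eq_mk_iff']
  exact ⟨s, hs.symm⟩

theorem exists_eq_supportSet {X : Finset (Plane k)} (hP : apex k ∈ X)
    (hX : ∀ Q ∈ X, VanishesAt F Q) :
    ∃ U : Finset k, (∀ u ∈ U, q.eval u ≠ 0) ∧ X = supportSet q c U := by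
  classical
  -- Keeping membership inside the existential yields a total parameter function; its value 0 off
  -- the set is never used.
  have key : ∀ p : Plane k, ∃ u, p ∈ X.erase (apex k) → q.eval u ≠ 0 ∧ p = curvePoint q c u := by
    intro p
    by_cases hp : p ∈ X.erase (apex k)
    · obtain ⟨u, hu⟩ := h.eq_curvePoint (hX p (Finset.mem_of_mem_erase hp))
        (Finset.ne_of_mem_erase hp)
      exact ⟨u, fun _ => hu⟩
    · exact ⟨0, fun h => absurd h hp⟩
  choose f hf using key
  refine ⟨(X.erase (apex k)).image f, ?_, ?_⟩
  · rw [Finset.forall_mem_image]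
    exact fun p hp => (hf p hp).1
  · rw [supportSet, Finset.image_image, ← Finset.insert_erase hP]
    rw [Finset.erase_insert (Finset.notMem_erase _ _)]
    congr 1
    conv_lhs => rw [← Finset.image_id (s := X.erase (apex k))]
    exact Finset.image_congr fun p hp => (hf p hp).2

theorem vanishesAt_supportSet (hP : VanishesAt F (apex k)) (hU : ∀ u ∈ U, q.eval u ≠ 0) :
    ∀ Q ∈ supportSet q c U, VanishesAt F Q := by
  classical
  rw [supportSet, Finset.forall_mem_insert, Finset.forall_mem_image]
  refine ⟨hP, fun u hu => ?_⟩
  rw [curvePoint_eq (hU u hu), vanishesAt_mk h.hom]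
  exact h.eval_self u

end IsParamCubic

end Support

/-! ### From the dimensions to the difference tables -/

section Tables

/-- The values of the Hilbert function of the double points in terms of the postulation `j` of
the `n` smooth support points. -/
structure IsDoubleHilbertFn (f j : ℕ → ℕ) (n : ℕ) : Prop where
  zero : f 0 = 1
  one : f 1 = 3
  two : f 2 = 6
  three : f 3 + (6 - 2 * n) + j 0 = 10
  add_four : ∀ e, f (e + 4) + (3 * e + 9 - 2 * n) + j (e + 1) = 6 * e + 15

theorem firstDiff_succ (f : ℕ → ℕ) (d : ℕ) : firstDiff f (d + 1) = (f (d + 1) : ℤ) - f d := rfl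

namespace IsDoubleHilbertFn

variable {f j : ℕ → ℕ} {n : ℕ} (h : IsDoubleHilbertFn f j n)
include h

/-- Through degree 4 both corrections vanish, since n ≥ 6 and j(0) = j(1) = 0, so h is the Hilbert
function of the plane there. From degree 5 on, 6 is lowered by the increments of the two
corrections. -/
theorem firstDiff_eq {T : ℕ → ℤ} (hn : 6 ≤ n) (h0 : j 0 = 0) (h1 : j 1 = 0)
    (hT : ∀ d ≤ 4, T d = d + 1)
    (h5 : ∀ e, T (e + 5) = 6 - ((3 * e + 12 - 2 * n : ℕ) : ℤ) + ((3 * e + 9 - 2 * n : ℕ) : ℤ) -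
      j (e + 2) + j (e + 1)) : firstDiff f = T := by
  funext d
  have a0 := h.zero
  have a1 := h.one
  have a2 := h.two
  have a3 := h.three
  have a4 := h.add_four 0
  rw [zero_add, zero_add] at a4
  match d with
  | 0 => rw [hT 0 (by omega), firstDiff, a0]; rfl
  | 1 => rw [hT 1 (by omega), firstDiff_succ, zero_add]; omega
  | 2 => rw [hT 2 (by omega), firstDiff_succ, one_add_one_eq_two]; omega
  | 3 => rw [hT 3 (by omega), firstDiff_succ, show 2 + 1 = 3 from rfl]; omega
  | 4 => rw [hT 4 (by omega), firstDiff_succ, show 3 + 1 = 4 from rfl]; omega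
  | e + 5 =>
    have c0 := h.add_four e
    have c1 := h.add_four (e + 1)
    rw [show e + 1 + 4 = e + 4 + 1 by omega, show e + 1 + 1 = e + 2 from rfl] at c1
    rw [h5 e, firstDiff_succ]
    omega

theorem firstDiff_eq_table0 {t : ℕ} (ht : 3 < t) (hn : n + 1 = 3 * t)
    (hj : ∀ e, j e = 3 * e - n) : firstDiff f = table0 t := by
  refine h.firstDiff_eq (by omega) (by rw [hj]; omega) (by rw [hj]; omega)
    (fun d hd => by rw [table0, if_pos hd]) fun e => ?_
  rw [hj, hj, table0]
  split_ifs <;> omega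

theorem firstDiff_eq_table1a {t : ℕ} (ht : 3 < t) (hn : n = 3 * t)
    (hj : ∀ e, j e = 3 * e - n) : firstDiff f = table1a t := by
  refine h.firstDiff_eq (by omega) (by rw [hj]; omega) (by rw [hj]; omega)
    (fun d hd => by rw [table1a, if_pos hd]) fun e => ?_
  rw [hj, hj, table1a]
  split_ifs <;> omega

/-- The extra form in degree t moves one unit from degree t + 3 to degree t + 4, compared with
`table1a`. -/
theorem firstDiff_eq_table1b {t : ℕ} (ht : 3 < t) (hn : n = 3 * t)
    (hj : ∀ e, j e = 3 * e - n + if 3 * e = n then 1 else 0) : firstDiff f = table1b t := by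
  refine h.firstDiff_eq (by omega) (by rw [hj, if_neg (by omega)]; omega)
    (by rw [hj, if_neg (by omega)]; omega)
    (fun d hd => by rw [table1b, if_pos hd]) fun e => ?_
  rw [hj, hj, table1b]
  split_ifs <;> omega

theorem firstDiff_eq_table2 {t : ℕ} (ht : 3 < t) (hn : n = 3 * t + 1)
    (hj : ∀ e, j e = 3 * e - n) : firstDiff f = table2 t := by
  refine h.firstDiff_eq (by omega) (by rw [hj]; omega) (by rw [hj]; omega)
    (fun d hd => by rw [table2, if_pos hd]) fun e => ?_
  rw [hj, hj, table2]
  split_ifs <;> omega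

end IsDoubleHilbertFn

variable {k : Type*} [Field k] {q c : k[X]} {U : Finset k}

theorem IsParam.finrank_curveFormsThrough_rootPoly (h : IsParam q c)
    (hU : ∀ u ∈ U, q.eval u ≠ 0) {e : ℕ} (he : 3 * e ≠ U.card) :
    Module.finrank k (curveFormsThrough q c (rootPoly U) e) = 3 * e - U.card := by
  rcases lt_or_gt_of_ne he with hlt | hgt
  · rw [h.curveFormsThrough_eq_bot (rootPoly_ne_zero U) (natDegree_rootPoly U) hlt, finrank_bot]
    omega
  · exact h.finrank_curveFormsThrough_of_lt (rootPoly_ne_zero U) (natDegree_rootPoly U) hgt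
      (rootPoly_coeff_zero_ne_zero hU)

namespace IsParamCubic

variable {F : MvPolynomial (Fin 3) k} (h : IsParamCubic F q c)
include h

theorem isDoubleHilbertFn [IsAlgClosed k] (hU : ∀ u ∈ U, q.eval u ≠ 0) (hcard : 6 ≤ U.card) :
    IsDoubleHilbertFn (hilbertFn (fatIdeal 2 (supportSet q c U)))
      (fun e => Module.finrank k (curveFormsThrough q c (rootPoly U) e)) U.card := by
  have hlow : ∀ d < 3, hilbertFn (fatIdeal 2 (supportSet q c U)) d =
      Module.finrank k (curveForms q c d) := by
    intro d hd
    have h1 := hilbertFn_supportSet_add (c := c) hU d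
    have h2 := h.finrank_doubleForms_of_lt hU hcard hd
    omega
  have hhigh : ∀ d, hilbertFn (fatIdeal 2 (supportSet q c U)) (3 + d) +
      (3 * (3 + d) - 3 - 2 * U.card) + Module.finrank k (curveFormsThrough q c (rootPoly U) d) =
      Module.finrank k (curveForms q c (3 + d)) + Module.finrank k (curveForms q c d) := by
    intro d
    have h1 := hilbertFn_supportSet_add (c := c) hU (3 + d)
    have h2 := h.finrank_doubleForms_add_three hU hcard d
    omega
  refine ⟨?_, ?_, ?_, ?_, fun e => ?_⟩
  · rw [hlow 0 (by omega), h.finrank_curveForms_zero]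
  · rw [hlow 1 (by omega), h.finrank_curveForms one_ne_zero, mul_one]
  · rw [hlow 2 (by omega), h.finrank_curveForms two_ne_zero]
  · have := hhigh 0
    rwa [h.finrank_curveForms_zero, h.finrank_curveForms (by omega)] at this
  · have := hhigh (e + 1)
    rw [h.finrank_curveForms (by omega), h.finrank_curveForms (by omega),
      show 3 + (e + 1) = e + 4 by omega] at this
    omega

theorem doubleDiff_eq_table0 [IsAlgClosed k] (hU : ∀ u ∈ U, q.eval u ≠ 0) {t : ℕ} (ht : 3 < t)
    (hn : U.card + 1 = 3 * t) : doubleDiff (supportSet q c U) = table0 t :=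
  (h.isDoubleHilbertFn hU (by omega)).firstDiff_eq_table0 ht hn fun _ =>
    h.finrank_curveFormsThrough_rootPoly hU (by omega)

theorem doubleDiff_eq_table2 [IsAlgClosed k] (hU : ∀ u ∈ U, q.eval u ≠ 0) {t : ℕ} (ht : 3 < t)
    (hn : U.card = 3 * t + 1) : doubleDiff (supportSet q c U) = table2 t :=
  (h.isDoubleHilbertFn hU (by omega)).firstDiff_eq_table2 ht hn fun _ =>
    h.finrank_curveFormsThrough_rootPoly hU (by omega)

theorem doubleDiff_eq_table1a [IsAlgClosed k] (hU : ∀ u ∈ U, q.eval u ≠ 0) {t : ℕ} (ht : 3 < t)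
    (hn : U.card = 3 * t) (hg : gluing q c t (rootPoly U) ≠ 0) :
    doubleDiff (supportSet q c U) = table1a t := by
  refine (h.isDoubleHilbertFn hU (by omega)).firstDiff_eq_table1a ht hn fun e => ?_
  by_cases he : 3 * e = U.card
  · obtain rfl : e = t := by omega
    rw [h.finrank_curveFormsThrough_of_gluing_ne (rootPoly_ne_zero U) (natDegree_rootPoly U)
      (by omega) hn hg]
    omega
  · exact h.finrank_curveFormsThrough_rootPoly hU he

theorem doubleDiff_eq_table1b [IsAlgClosed k] (hU : ∀ u ∈ U, q.eval u ≠ 0) {t : ℕ} (ht : 3 < t)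
    (hn : U.card = 3 * t) (hg : gluing q c t (rootPoly U) = 0) :
    doubleDiff (supportSet q c U) = table1b t := by
  refine (h.isDoubleHilbertFn hU (by omega)).firstDiff_eq_table1b ht hn fun e => ?_
  by_cases he : 3 * e = U.card
  · obtain rfl : e = t := by omega
    rw [h.finrank_curveFormsThrough_of_gluing_eq (rootPoly_ne_zero U) (natDegree_rootPoly U)
      (by omega) hn hg, if_pos he]
    omega
  · rw [h.finrank_curveFormsThrough_rootPoly hU he, if_neg he, add_zero]

theorem hasTables [IsAlgClosed k] (hP : VanishesAt F (apex k)) {t : ℕ} (ht : 3 < t)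
    (ha : ∃ U : Finset k, (∀ u ∈ U, q.eval u ≠ 0) ∧ U.card = 3 * t ∧
      gluing q c t (rootPoly U) ≠ 0)
    (hb : ∃ U : Finset k, (∀ u ∈ U, q.eval u ≠ 0) ∧ U.card = 3 * t ∧
      gluing q c t (rootPoly U) = 0) : HasTables F (apex k) t := by
  classical
  refine ⟨fun X hX hXF => ?_, ?_, ?_⟩
  · obtain ⟨U, hU, rfl⟩ := h.exists_eq_supportSet hX hXF
    rw [card_supportSet hU]
    refine ⟨fun hn => h.doubleDiff_eq_table0 hU ht hn, fun hn => ?_,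
      fun hn => h.doubleDiff_eq_table2 hU ht (by omega)⟩
    by_cases hg : gluing q c t (rootPoly U) = 0
    · exact Or.inr (h.doubleDiff_eq_table1b hU ht (by omega) hg)
    · exact Or.inl (h.doubleDiff_eq_table1a hU ht (by omega) hg)
  · obtain ⟨U, hU, hn, hg⟩ := ha
    exact ⟨supportSet q c U, Finset.mem_insert_self _ _, h.vanishesAt_supportSet hP hU,
      by rw [card_supportSet hU, hn], h.doubleDiff_eq_table1a hU ht hn hg⟩
  · obtain ⟨U, hU, hn, hg⟩ := hb
    exact ⟨supportSet q c U, Finset.mem_insert_self _ _, h.vanishesAt_supportSet hP hU,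
      by rw [card_supportSet hU, hn], h.doubleDiff_eq_table1b hU ht hn hg⟩

end IsParamCubic

end Tables

end FatPoints

namespace FatPoints

open Polynomial

/-! ### Existence of both configurations of 3t + 1 points -/

section Existence

/-- Exchanging one element changes the product, so of two sets differing in one element at most one
has product g. -/
theorem exists_finset_prod_ne {Γ : Type*} [CommGroup Γ] [Infinite Γ] {n : ℕ} (hn : n ≠ 0) (g : Γ) :
    ∃ S : Finset Γ, S.card = n ∧ ∏ x ∈ S, x ≠ g := by
  classical
  obtain ⟨m, rfl⟩ := Nat.exists_eq_succ_of_ne_zero hn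
  obtain ⟨S, hS⟩ := Infinite.exists_subset_card_eq Γ m
  obtain ⟨a, ha⟩ := Infinite.exists_notMem_finset S
  obtain ⟨b, hb⟩ := Infinite.exists_notMem_finset (insert a S)
  rw [Finset.mem_insert, not_or] at hb
  by_cases h : ∏ x ∈ insert a S, x = g
  · refine ⟨insert b S, by rw [Finset.card_insert_of_notMem hb.2, hS], fun h' => hb.1 ?_⟩
    rw [Finset.prod_insert ha] at h
    rw [Finset.prod_insert hb.2, ← h] at h'
    exact mul_right_cancel h'
  · exact ⟨_, by rw [Finset.card_insert_of_notMem ha, hS], h⟩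

/-- All but two elements are chosen with product different from g, and a pair a, r / a supplies the
missing factor r ≠ 1. The case r = 1 must be avoided because in characteristic 2 every a in k
satisfies a + a = 0. -/
theorem exists_finset_prod_eq {Γ : Type*} [CommGroup Γ] [Infinite Γ]
    (hsq : ∀ h : Γ, h ≠ 1 → {a : Γ | a * a = h}.Finite) {n : ℕ} (hn : 3 ≤ n) (g : Γ) :
    ∃ S : Finset Γ, S.card = n ∧ ∏ x ∈ S, x = g := by
  classical
  obtain ⟨m, rfl⟩ : ∃ m, n = m + 2 := ⟨n - 2, by omega⟩
  obtain ⟨S, hS, hSg⟩ := exists_finset_prod_ne (show m ≠ 0 by omega) g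
  set r := g / ∏ x ∈ S, x with hr
  have hr1 : r ≠ 1 := fun h => hSg (div_eq_one.1 h).symm
  -- The three excluded finite sets ensure a ∉ S, r / a ∉ S and a ≠ r / a.
  obtain ⟨a, ha⟩ := Infinite.exists_notMem_finset
    (S ∪ S.image (fun s => r / s) ∪ (hsq r hr1).toFinset)
  simp only [Finset.mem_union, Finset.mem_image, Set.Finite.mem_toFinset, Set.mem_ofPred_eq,
    not_or, not_exists, not_and] at ha
  obtain ⟨⟨ha1, ha2⟩, ha3⟩ := ha
  have hb : r / a ∉ S := fun hmem => ha2 _ hmem (by simp)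
  have hab : a ∉ insert (r / a) S := by
    rw [Finset.mem_insert, not_or]
    exact ⟨fun h => ha3 (eq_div_iff_mul_eq'.1 h), ha1⟩
  refine ⟨insert a (insert (r / a) S), ?_, ?_⟩
  · rw [Finset.card_insert_of_notMem hab, Finset.card_insert_of_notMem hb, hS]
  · rw [Finset.prod_insert hab, Finset.prod_insert hb, ← mul_assoc, mul_div_cancel, hr,
      div_mul_cancel]

variable {k : Type*} [Field k]

theorem coeff_rootPoly_card (U : Finset k) : (rootPoly U).coeff U.card = 1 := by
  rw [← natDegree_rootPoly U]
  exact monic_prod_of_monic _ _ fun u _ => monic_X_sub_C u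

/-- L is monic of degree 3t, so the condition fixes its constant coefficient, which is the product
of the negated roots. -/
theorem gluing_node_eq_zero_iff {c : k[X]} (h : IsParam X c) {t : ℕ} {U : Finset k}
    (hn : U.card = 3 * t) : gluing X c t (rootPoly U) = 0 ↔
      ∏ u ∈ U, (-u) = (c ^ t).coeff 0 / (c ^ t).coeff (3 * t) := by
  have h0 : (rootPoly U).coeff 0 = ∏ u ∈ U, (-u) := by
    rw [coeff_zero_eq_eval_zero, rootPoly, eval_prod]
    simp
  rw [gluing_apply, ← hn, coeff_rootPoly_card, pivot, if_pos rfl, h0, hn,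
    eq_div_iff (h.coeff_c_pow_ne_zero t), sub_eq_zero, mul_one, mul_comm]

/-- Here the condition fixes the coefficient of L below the leading one, which is the sum of the
negated roots. -/
theorem gluing_cusp_eq_zero_iff {c : k[X]} (h : IsParam 1 c) {t : ℕ} (ht : t ≠ 0) {U : Finset k}
    (hn : U.card = 3 * t) : gluing 1 c t (rootPoly U) = 0 ↔
      ∑ u ∈ U, (-u) = (c ^ t).coeff (3 * t - 1) / (c ^ t).coeff (3 * t) := by
  have h0 : (rootPoly U).coeff (3 * t - 1) = ∑ u ∈ U, (-u) := by
    rw [← hn, Finset.sum_neg_distrib]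
    exact prod_X_sub_C_coeff_card_pred U (fun u => u) (by omega)
  rw [gluing_apply, ← hn, coeff_rootPoly_card, pivot, if_neg one_ne_X, hn, h0,
    eq_div_iff (h.coeff_c_pow_ne_zero t), sub_eq_zero, mul_one, mul_comm]

theorem finite_units_sq_eq (r : kˣ) : {a : kˣ | a * a = r}.Finite := by
  rcases Set.eq_empty_or_nonempty {a : kˣ | a * a = r} with h | ⟨b, hb⟩
  · rw [h]
    exact Set.finite_empty
  · refine Set.Finite.subset (Set.toFinite {b, -b}) fun a ha => ?_
    have : (a : k) * a = b * b := by
      rw [← Units.val_mul, ← Units.val_mul, ha, hb]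
    rcases mul_self_eq_mul_self_iff.1 this with h | h
    · exact Or.inl (Units.ext h)
    · exact Or.inr (Units.ext (by simpa using h))

theorem finite_add_self_eq (r : Multiplicative k) (hr : r ≠ 1) :
    {a : Multiplicative k | a * a = r}.Finite := by
  refine Set.Subsingleton.finite fun a ha b hb => ?_
  have ha' : a.toAdd + a.toAdd = r.toAdd := congrArg Multiplicative.toAdd ha
  have hb' : b.toAdd + b.toAdd = r.toAdd := congrArg Multiplicative.toAdd hb
  have hr' : r.toAdd ≠ 0 := fun h => hr (Multiplicative.toAdd.injective h)
  -- In characteristic 2 a solution would force r to be trivial, so the set is empty there.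
  have h2 : (2 : k) ≠ 0 := by
    intro h2
    rw [← two_mul, h2, zero_mul] at ha'
    exact hr' ha'.symm
  refine Multiplicative.toAdd.injective (mul_left_cancel₀ h2 ?_)
  rw [two_mul, two_mul, ha', hb']

variable [IsAlgClosed k]

theorem infinite_units : Infinite kˣ := by
  have : Infinite k := IsAlgClosed.instInfinite
  have : Infinite ({0}ᶜ : Set k) := (Set.finite_singleton (0 : k)).infinite_compl.to_subtype
  exact Infinite.of_injective (fun x : ({0}ᶜ : Set k) => Units.mk0 (x : k) x.2) fun x y hxy =>
    Subtype.ext (congrArg Units.val hxy)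

theorem hasTables_node {t : ℕ} (ht : 3 < t) {c₀ c₁ c₂ c₃ : k} (h₀ : c₀ ≠ 0) (h₃ : c₃ ≠ 0)
    (hF : (conicCubic 0 1 0 c₀ c₁ c₂ c₃).IsHomogeneous 3)
    (hirr : Irreducible (conicCubic 0 1 0 c₀ c₁ c₂ c₃)) :
    HasTables (conicCubic 0 1 0 c₀ c₁ c₂ c₃) (apex k) t := by
  classical
  have : Infinite kˣ := infinite_units
  have h := isParamCubic_node h₀ h₃ hF hirr
  set c := C c₀ * X ^ 3 + C c₁ * X ^ 2 + C c₂ * X + C c₃ with hc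
  have hr : (c ^ t).coeff 0 / (c ^ t).coeff (3 * t) ≠ 0 := by
    refine div_ne_zero ?_ (h.coeff_c_pow_ne_zero t)
    rw [coeff_zero_eq_eval_zero, eval_pow]
    exact pow_ne_zero _ (by simpa [hc] using h₃)
  set r := Units.mk0 _ hr with hr'
  -- Negated units serve as parameters, so that Vieta's product of the -u is the product of the
  -- chosen units.
  have inj : Function.Injective fun v : kˣ => -(v : k) := fun a b hab =>
    Units.ext (neg_injective hab)
  have key : ∀ S : Finset kˣ, S.card = 3 * t →
      (∀ u ∈ S.image fun v : kˣ => -(v : k), (X : k[X]).eval u ≠ 0) ∧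
      (S.image fun v : kˣ => -(v : k)).card = 3 * t ∧
      (gluing X c t (rootPoly (S.image fun v : kˣ => -(v : k))) = 0 ↔ ∏ v ∈ S, v = r) := by
    intro S hS
    have hcard : (S.image fun v : kˣ => -(v : k)).card = 3 * t := by
      rw [Finset.card_image_of_injective _ inj, hS]
    refine ⟨?_, hcard, ?_⟩
    · rw [Finset.forall_mem_image]
      intro v _
      simp
    · rw [gluing_node_eq_zero_iff h.toIsParam hcard, Finset.prod_image inj.injOn, Units.ext_iff]
      simp [hr']
  refine h.hasTables ?_ ht ?_ ?_
  · rw [apex, vanishesAt_mk hF, eval_conicCubic]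
    simp [apexVec]
  · obtain ⟨S, hS, hSr⟩ := exists_finset_prod_ne (show 3 * t ≠ 0 by omega) r
    exact ⟨_, (key S hS).1, (key S hS).2.1, fun hg => hSr ((key S hS).2.2.1 hg)⟩
  · obtain ⟨S, hS, hSr⟩ := exists_finset_prod_eq (fun r _ => finite_units_sq_eq r)
      (show 3 ≤ 3 * t by omega) r
    exact ⟨_, (key S hS).1, (key S hS).2.1, (key S hS).2.2.2 hSr⟩

theorem hasTables_cusp {t : ℕ} (ht : 3 < t) {c₀ c₁ c₂ c₃ : k} (h₀ : c₀ ≠ 0)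
    (hF : (conicCubic 1 0 0 c₀ c₁ c₂ c₃).IsHomogeneous 3)
    (hirr : Irreducible (conicCubic 1 0 0 c₀ c₁ c₂ c₃)) :
    HasTables (conicCubic 1 0 0 c₀ c₁ c₂ c₃) (apex k) t := by
  classical
  have : Infinite k := IsAlgClosed.instInfinite
  have h := isParamCubic_cusp h₀ hF hirr
  set c := C c₀ * X ^ 3 + C c₁ * X ^ 2 + C c₂ * X + C c₃ with hc
  set r := (c ^ t).coeff (3 * t - 1) / (c ^ t).coeff (3 * t) with hr
  have inj : Function.Injective fun v : Multiplicative k => -v.toAdd := fun a b hab =>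
    Multiplicative.toAdd.injective (neg_injective hab)
  have key : ∀ S : Finset (Multiplicative k), S.card = 3 * t →
      (∀ u ∈ S.image fun v : Multiplicative k => -v.toAdd, (1 : k[X]).eval u ≠ 0) ∧
      (S.image fun v : Multiplicative k => -v.toAdd).card = 3 * t ∧
      (gluing 1 c t (rootPoly (S.image fun v : Multiplicative k => -v.toAdd)) = 0 ↔
        ∏ v ∈ S, v = Multiplicative.ofAdd r) := by
    intro S hS
    have hcard : (S.image fun v : Multiplicative k => -v.toAdd).card = 3 * t := by
      rw [Finset.card_image_of_injective _ inj, hS]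
    refine ⟨fun u _ => by simp, hcard, ?_⟩
    rw [gluing_cusp_eq_zero_iff h.toIsParam (by omega) hcard, Finset.sum_image inj.injOn,
      ← Multiplicative.toAdd.injective.eq_iff, toAdd_prod]
    simp [hr]
  refine h.hasTables ?_ ht ?_ ?_
  · rw [apex, vanishesAt_mk hF, eval_conicCubic]
    simp [apexVec]
  · obtain ⟨S, hS, hSr⟩ := exists_finset_prod_ne (show 3 * t ≠ 0 by omega)
      (Multiplicative.ofAdd r)
    exact ⟨_, (key S hS).1, (key S hS).2.1, fun hg => hSr ((key S hS).2.2.1 hg)⟩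
  · obtain ⟨S, hS, hSr⟩ := exists_finset_prod_eq finite_add_self_eq
      (show 3 ≤ 3 * t by omega) (Multiplicative.ofAdd r)
    exact ⟨_, (key S hS).1, (key S hS).2.1, (key S hS).2.2.2 hSr⟩

end Existence

end FatPoints

theorem theorem3p5 {k : Type*} [Field k] [IsAlgClosed k]
    (F : MvPolynomial (Fin 3) k) (hF : F.IsHomogeneous 3) (hirr : Irreducible F)
    (P : FatPoints.Plane k) (hP : FatPoints.IsSingularPoint F P)
    (t : ℕ) (ht : 3 < t) :
    (∀ X : Finset (FatPoints.Plane k), P ∈ X → (∀ Q ∈ X, FatPoints.VanishesAt F Q) →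
      (X.card = 3 * t → FatPoints.doubleDiff X = FatPoints.table0 t) ∧
      (X.card = 3 * t + 1 →
        FatPoints.doubleDiff X = FatPoints.table1a t ∨
        FatPoints.doubleDiff X = FatPoints.table1b t) ∧
      (X.card = 3 * t + 2 → FatPoints.doubleDiff X = FatPoints.table2 t)) ∧
    (∃ X : Finset (FatPoints.Plane k), P ∈ X ∧ (∀ Q ∈ X, FatPoints.VanishesAt F Q) ∧
      X.card = 3 * t + 1 ∧ FatPoints.doubleDiff X = FatPoints.table1a t) ∧
    (∃ X : Finset (FatPoints.Plane k), P ∈ X ∧ (∀ Q ∈ X, FatPoints.VanishesAt F Q) ∧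
      X.card = 3 * t + 1 ∧ FatPoints.doubleDiff X = FatPoints.table1b t) := by
  exact FatPoints.hasTables_of_normalForm
    (fun _ _ _ _ h₀ hF hirr => FatPoints.hasTables_cusp ht h₀ hF hirr)
    (fun _ _ _ _ h₀ h₃ hF hirr => FatPoints.hasTables_node ht h₀ h₃ hF hirr) hF hirr hP
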